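/- Let $\alpha,\beta$ be integers with $0\le\beta<\alpha$, let $\mathrm{sign}(x)=1$ for $x\ge 0$ and $\mathrm{sign}(x)=-1$ for $x<0$, and let $\mathcal F:\mathbb Z^2\to\mathbb Z^2$ be the bijection $\mathcal F(x,y)=(x+\alpha(y-\mathrm{sign}\,x)+\beta,\ y-\mathrm{sign}\,x)$. Let $\mathrm F$ be the first-return map of $\mathcal F$ to the ray $\mathbb Z_+=\{(x,0): x\in\mathbb Z,\ x\ge 0\}$, and let $\overline\alpha=\alpha/\gcd(\alpha,2\beta)$. A subset $S$ of $\mathbb Z_+$ has full density if $\#\{(x,0)\in S: 0\le x\le N\}/(N+1)\to 1$ as $N\to\infty$, and a subset $S$ of $\mathbb Z^2$ has full density if $\#\{(x,y)\in S:|x|,|y|\le N\}/(2N+1)^2\to1$ as $N\to\infty$. A point is an escape point if $\|\mathcal F^t(p)\|\to\infty$ both as $t\to+\infty$ and as $t\to-\infty$. (i) If $\overline\alpha$ is odd, then the set of points of $\mathbb Z_+$ that are periodic under $\mathcal F$ and have minimal period $\overline\alpha$ under $\mathrm F$ has full density in $\mathbb Z_+$; and the set of points of $\mathbb Z^2$ that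 are periodic under $\mathcal F$ and whose orbit meets $\mathbb Z_+$ in a point of minimal period $\overline\alpha$ under $\mathrm F$ has full density in $\mathbb Z^2$. (ii) If $\overline\alpha$ is even, then the set of escape points in $\mathbb Z_+$ has full density in $\mathbb Z_+$, and the set of escape points in $\mathbb Z^2$ has full density in $\mathbb Z^2$. -/

import Mathlib

open Filter Topology

/-- The sign function with value `1` at `0`. -/
def latticeSign (x : ℤ) : ℤ := if 0 ≤ x then 1 else -1

/-- The lattice map `(x, y) ↦ (x + α (y - sign x) + β, y - sign x)`, as a bijection of `ℤ²`
together with its inverse. -/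
def latticeMap (α β : ℕ) : Equiv.Perm (ℤ × ℤ) where
  toFun p := (p.1 + α * (p.2 - latticeSign p.1) + β, p.2 - latticeSign p.1)
  invFun p := (p.1 - α * p.2 - β, p.2 + latticeSign (p.1 - α * p.2 - β))
  left_inv p := by
    have h : p.1 + α * (p.2 - latticeSign p.1) + β - α * (p.2 - latticeSign p.1) - β = p.1 := by
      ring
    ext
    · exact h
    · simp only [h]
      ring
  right_inv p := by
    ext
    · simp only
      ring
    · simp only
      ring

/-- The ray of the points `(x, 0)` with `0 ≤ x`. -/
def positiveRay : Set (ℤ × ℤ) := {p | 0 ≤ p.1 ∧ p.2 = 0}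

/-- The first positive time at which the orbit of `p` is on the ray. -/
noncomputable def returnTime (α β : ℕ) (p : ℤ × ℤ) : ℕ :=
  sInf {t : ℕ | 0 < t ∧ (latticeMap α β)^[t] p ∈ positiveRay}

/-- The first-return map to the ray, to be applied to points of the ray. -/
noncomputable def firstReturn (α β : ℕ) (p : ℤ × ℤ) : ℤ × ℤ :=
  (latticeMap α β)^[returnTime α β p] p

/-- `p` is a periodic point of the lattice map. -/
def IsPeriodicPoint (α β : ℕ) (p : ℤ × ℤ) : Prop :=
  p ∈ Function.periodicPts (latticeMap α β)

/-- The orbit of `p` escapes to infinity, in both time directions. -/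
def IsEscapePoint (α β : ℕ) (p : ℤ × ℤ) : Prop :=
  Tendsto (fun t : ℕ => ‖(latticeMap α β)^[t] p‖) atTop atTop ∧
    Tendsto (fun t : ℕ => ‖(latticeMap α β).symm^[t] p‖) atTop atTop

/-- `α / gcd(α, 2β)`; the division is exact. -/
def alphaBar (α β : ℕ) : ℕ := α / Nat.gcd α (2 * β)

/-- The set `S` has density `1` with respect to the sequence of finite sets `B N`. -/
def HasFullDensity {X : Type*} (B : ℕ → Finset X) (S : Set X) : Prop :=
  Tendsto (fun N : ℕ => ((S ∩ (B N : Set X)).ncard : ℝ) / ((B N).card : ℝ)) atTop (𝓝 1)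

/-- The points `(x, 0)` with `0 ≤ x ≤ N`. -/
noncomputable def raySegment (N : ℕ) : Finset (ℤ × ℤ) := Finset.Icc (0 : ℤ) (N : ℤ) ×ˢ {(0 : ℤ)}

/-- The points `(x, y)` with `|x| ≤ N` and `|y| ≤ N`. -/
noncomputable def squareBox (N : ℕ) : Finset (ℤ × ℤ) :=
  Finset.Icc (-(N : ℤ)) (N : ℤ) ×ˢ Finset.Icc (-(N : ℤ)) (N : ℤ)

/-!
In the half plane `0 ≤ x` the quantity `z = x + α y (y - 1) / 2 + β y` is conserved, and in `x < 0`
so is `x - α y (y + 1) / 2 - β y`; the orbit alternates between arcs of two families of parabolas.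
A turn around the origin is determined by the height `n` at which the orbit leaves `0 ≤ x` and the
distance `s` of that crossing from the axis `x = 0` (`IsTurn.firstReturn_eq`, `isTurn_rayPt`,
`next_rayPt`).

Let `g = gcd(α, 2β)`, `A = α / g` and `2β = g a`. Write `s = ρ g n + e` with `0 ≤ ρ < A` and
`0 ≤ e < g n`. All discontinuities of a half turn are, up to bounded errors, multiples of `g n`.
So if `e` stays a bounded distance inside `(0, g n)` (`IsDeep`), the next `2A` half turns act on `ρ`
exactly as the rotation `ρ ↦ ρ - a` of `ℤ / A`, and the changes of `n` and `e` are alternating sums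
of functions of `ρ` (`IsDeep.iterate`).

* If `A` is odd, the alternating sums over `2A` half turns cancel in pairs, because the rotation has
  period `A`. So the return map has period `A`, and no smaller one since `a` and `2` are units
  modulo `A` (`IsDeep.isPeriodic_of_odd`).
* If `A` is even, then `a` is odd, the parity of `ρ` alternates, and the alternating sums over `A`
  half turns become sums over all residues. They give `n ↦ n ± 1` and `e ↦ e ± g / 2`, with the sign
  `+` for odd `ρ` and `-` for even `ρ` (`IsDeep.iterate_of_even`). In both cases all the points
  `(n + k, e + k g / 2)` are deep and belong to one orbit: its future for odd `ρ`, its past for even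
  `ρ`. So the orbit is infinite (`IsDeep.not_isPeriodicPoint`). An infinite orbit of a bijection of
  `ℤ²` visits no point twice, and hence escapes in both directions (`isEscapePoint_iff`).

On the ray, each level `n` has a bounded number of points that are not deep, and there are `O(√N)`
levels below `N` (`hasFullDensity_raySegment`). The planar statements follow because both sets are
invariant: outside a thin strip around `y = 0`, a point of the box reaches `0 ≤ x` after a bounded
number of steps and from there the ray along its parabola, and boundedly many points of the box lead
to the same point of the ray (`hasFullDensity_squareBox`).
-/

section

variable {α β : ℕ}

/-! ### Parabolas and the first-return map -/

/-- The triangular number `y (y + 1) / 2` of an integer; the division is exact. -/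
def tri (y : ℤ) : ℤ := y * (y + 1) / 2

lemma two_mul_tri (y : ℤ) : 2 * tri y = y * (y + 1) :=
  Int.mul_ediv_cancel' (Int.even_mul_succ_self y).two_dvd

/-- The point at height `y` of the parabola that carries an orbit through the half plane `0 ≤ x`;
`z` is the abscissa at which the parabola meets the axis `y = 0`. -/
def rightPt (α β : ℕ) (z y : ℤ) : ℤ × ℤ := (z - α * tri (y - 1) - β * y, y)

/-- The point at height `y` of the parabola that carries an orbit through the half plane `x < 0`;
`w` is the abscissa at which the parabola meets the axis `y = 0`. -/
def leftPt (α β : ℕ) (w y : ℤ) : ℤ × ℤ := (w + α * tri y + β * y, y)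

lemma latticeMap_of_nonneg {p : ℤ × ℤ} (h : 0 ≤ p.1) :
    latticeMap α β p = (p.1 + α * (p.2 - 1) + β, p.2 - 1) := by
  simp [latticeMap, latticeSign, h]

lemma latticeMap_of_neg {p : ℤ × ℤ} (h : p.1 < 0) :
    latticeMap α β p = (p.1 + α * (p.2 + 1) + β, p.2 + 1) := by
  simp [latticeMap, latticeSign, not_le.2 h]

lemma latticeMap_rightPt {z y : ℤ} (h : 0 ≤ (rightPt α β z y).1) :
    latticeMap α β (rightPt α β z y) = rightPt α β z (y - 1) := by
  rw [latticeMap_of_nonneg h]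
  have h1 := two_mul_tri (y - 1)
  have h2 := two_mul_tri (y - 1 - 1)
  have h3 : tri (y - 1) = tri (y - 1 - 1) + (y - 1) := by linarith
  simp only [rightPt, Prod.mk.injEq, and_true, h3]
  ring

lemma latticeMap_leftPt {w y : ℤ} (h : (leftPt α β w y).1 < 0) :
    latticeMap α β (leftPt α β w y) = leftPt α β w (y + 1) := by
  rw [latticeMap_of_neg h]
  have h1 := two_mul_tri y
  have h2 := two_mul_tri (y + 1)
  have h3 : tri (y + 1) = tri y + (y + 1) := by linarith
  simp only [leftPt, Prod.mk.injEq, and_true, h3]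
  ring

lemma iterate_rightPt {z y : ℤ} {k : ℕ}
    (h : ∀ t : ℕ, t < k → 0 ≤ (rightPt α β z (y - t)).1) :
    (latticeMap α β)^[k] (rightPt α β z y) = rightPt α β z (y - k) := by
  induction k with
  | zero => simp
  | succ k ih =>
    rw [Function.iterate_succ_apply', ih fun t ht => h t (by omega),
      latticeMap_rightPt (h k (by omega))]
    congr 1
    push_cast
    ring

lemma iterate_leftPt {w y : ℤ} {k : ℕ}
    (h : ∀ t : ℕ, t < k → (leftPt α β w (y + t)).1 < 0) :
    (latticeMap α β)^[k] (leftPt α β w y) = leftPt α β w (y + k) := by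
  induction k with
  | zero => simp
  | succ k ih =>
    rw [Function.iterate_succ_apply', ih fun t ht => h t (by omega),
      latticeMap_leftPt (h k (by omega))]
    congr 1
    push_cast
    ring

/-- The right parabola is concave: an arc of it with both ends in `0 ≤ x` stays in `0 ≤ x`. -/
lemma rightPt_nonneg {z a b y : ℤ} (hay : a ≤ y) (hyb : y ≤ b)
    (ha : 0 ≤ (rightPt α β z a).1) (hb : 0 ≤ (rightPt α β z b).1) :
    0 ≤ (rightPt α β z y).1 := by
  simp only [rightPt] at *
  have h1 := two_mul_tri (y - 1)
  have h2 := two_mul_tri (a - 1)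
  have h3 := two_mul_tri (b - 1)
  by_contra! hneg
  have e1 : 0 < (y - a) * (α * (y + a - 1) + 2 * β) := by nlinarith
  have e2 : 0 < (y - b) * (α * (y + b - 1) + 2 * β) := by nlinarith
  have f1 : 0 < α * (y + a - 1) + 2 * (β : ℤ) := pos_of_mul_pos_right e1 (by omega)
  have f2 : α * (y + b - 1) + 2 * (β : ℤ) < 0 := by
    by_contra! hc
    exact absurd e2 (not_lt.2 (mul_nonpos_of_nonpos_of_nonneg (by omega) hc))
  have : (α : ℤ) * a ≤ α * b := mul_le_mul_of_nonneg_left (by omega) (by positivity)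
  nlinarith

/-- The left parabola is convex: an arc of it with both ends in `x < 0` stays in `x < 0`. -/
lemma leftPt_neg {w a b y : ℤ} (hay : a ≤ y) (hyb : y ≤ b)
    (ha : (leftPt α β w a).1 < 0) (hb : (leftPt α β w b).1 < 0) :
    (leftPt α β w y).1 < 0 := by
  simp only [leftPt] at *
  have h1 := two_mul_tri y
  have h2 := two_mul_tri a
  have h3 := two_mul_tri b
  by_contra! hneg
  have e1 : 0 < (y - a) * (α * (y + a + 1) + 2 * β) := by nlinarith
  have e2 : 0 < (y - b) * (α * (y + b + 1) + 2 * β) := by nlinarith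
  have f1 : 0 < α * (y + a + 1) + 2 * (β : ℤ) := pos_of_mul_pos_right e1 (by omega)
  have f2 : α * (y + b + 1) + 2 * (β : ℤ) < 0 := by
    by_contra! hc
    exact absurd e2 (not_lt.2 (mul_nonpos_of_nonpos_of_nonneg (by omega) hc))
  have : (α : ℤ) * a ≤ α * b := mul_le_mul_of_nonneg_left (by omega) (by positivity)
  nlinarith

lemma rightPt_zero (z : ℤ) : rightPt α β z 0 = (z, 0) := by
  simp [rightPt, tri]

lemma rightPt_eq_leftPt (z y : ℤ) :
    rightPt α β z y = leftPt α β (z - α * y ^ 2 - 2 * β * y) y := by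
  have h1 := two_mul_tri (y - 1)
  have h2 := two_mul_tri y
  have h3 : tri (y - 1) = y ^ 2 - tri y := by linarith
  simp only [rightPt, leftPt, h3, Prod.mk.injEq, and_true]
  ring

/-- A full turn around the origin. The orbit of `(z, 0)` first has `x < 0` at height `-n`, and then
first has `0 ≤ x` again at height `m`; the four inequalities say that the points just before and
just after the two crossings are on the correct sides. -/
structure IsTurn (α β : ℕ) (z : ℤ) (n m : ℕ) : Prop where
  n_pos : 0 < n
  m_pos : 0 < m
  before_exit : 0 ≤ (rightPt α β z (-n + 1)).1
  exit : (rightPt α β z (-n)).1 < 0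
  before_entry : (leftPt α β (z - α * n ^ 2 + 2 * β * n) (m - 1)).1 < 0
  entry : 0 ≤ (leftPt α β (z - α * n ^ 2 + 2 * β * n) m).1

namespace IsTurn

variable {z : ℤ} {n m : ℕ}

lemma iterate_right (h : IsTurn α β z n m) (hz : 0 ≤ z) {t : ℕ} (ht : t ≤ n) :
    (latticeMap α β)^[t] (z, 0) = rightPt α β z (-t) := by
  rw [← rightPt_zero (α := α) (β := β), iterate_rightPt, zero_sub]
  intro r hr
  exact rightPt_nonneg (a := -n + 1) (b := 0) (by omega) (by omega) h.before_exit
    (by rw [rightPt_zero]; exact hz)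

lemma left_neg (h : IsTurn α β z n m) {y : ℤ} (h1 : -(n : ℤ) ≤ y) (h2 : y < m) :
    (leftPt α β (z - α * n ^ 2 + 2 * β * n) y).1 < 0 := by
  refine leftPt_neg h1 (show y ≤ m - 1 by omega) ?_ h.before_entry
  have := h.exit
  rw [rightPt_eq_leftPt] at this
  convert this using 3
  ring

lemma iterate_left (h : IsTurn α β z n m) (hz : 0 ≤ z) {t : ℕ} (ht : t ≤ n + m) :
    (latticeMap α β)^[n + t] (z, 0) = leftPt α β (z - α * n ^ 2 + 2 * β * n) (-n + t) := by
  rw [add_comm n, Function.iterate_add_apply, h.iterate_right hz le_rfl, rightPt_eq_leftPt,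
    show z - α * (-n : ℤ) ^ 2 - 2 * β * (-n : ℤ) = z - α * n ^ 2 + 2 * β * n by ring,
    iterate_leftPt]
  intro r hr
  exact h.left_neg (by omega) (by omega)

lemma rightPt_entry : leftPt α β (z - α * n ^ 2 + 2 * β * n) m =
    rightPt α β (z + (m + n) * (α * (m - n) + 2 * β)) m := by
  rw [rightPt_eq_leftPt]
  congr 1
  ring

lemma next_nonneg (h : IsTurn α β z n m) : 0 ≤ z + (m + n) * (α * (m - n) + 2 * β) := by
  have h1 := h.entry
  rw [rightPt_entry] at h1
  simp only [rightPt] at h1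
  have h2 := two_mul_tri ((m : ℤ) - 1)
  have h3 : 0 ≤ tri ((m : ℤ) - 1) := by
    have : (0 : ℤ) ≤ (m - 1) * (m - 1 + 1) :=
      mul_nonneg (by have := h.m_pos; omega) (by omega)
    omega
  have h4 : (0 : ℤ) ≤ α * tri ((m : ℤ) - 1) := by positivity
  have h5 : (0 : ℤ) ≤ β * m := by positivity
  linarith

lemma iterate_back (h : IsTurn α β z n m) (hz : 0 ≤ z) {t : ℕ} (ht : t ≤ m) :
    (latticeMap α β)^[2 * n + m + t] (z, 0) =
      rightPt α β (z + (m + n) * (α * (m - n) + 2 * β)) (m - t) := by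
  rw [show 2 * n + m + t = t + (n + (n + m)) by ring, Function.iterate_add_apply,
    h.iterate_left hz le_rfl]
  push_cast
  rw [neg_add_cancel_left, rightPt_entry, iterate_rightPt]
  intro r hr
  refine rightPt_nonneg (a := 0) (b := m) (by omega) (by omega) ?_ ?_
  · rw [rightPt_zero]
    exact h.next_nonneg
  · rw [← rightPt_entry]
    exact h.entry

lemma iterate_eq (h : IsTurn α β z n m) (hz : 0 ≤ z) :
    (latticeMap α β)^[2 * (n + m)] (z, 0) =
      (z + (m + n) * (α * (m - n) + 2 * β), 0) := by
  rw [show 2 * (n + m) = 2 * n + m + m by ring, h.iterate_back hz le_rfl, sub_self, rightPt_zero]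

lemma returnTime_eq (h : IsTurn α β z n m) (hz : 0 ≤ z) :
    returnTime α β (z, 0) = 2 * (n + m) := by
  have hn := h.n_pos
  refine IsLeast.csInf_eq ⟨⟨by omega, ?_⟩, ?_⟩
  · rw [h.iterate_eq hz]
    exact ⟨h.next_nonneg, rfl⟩
  · rintro t ⟨ht0, ht⟩
    by_contra! hlt
    rcases le_or_gt t n with h1 | h1
    · rw [h.iterate_right hz h1] at ht
      have := ht.2
      simp only [rightPt] at this
      omega
    rcases lt_or_ge t (2 * n + m) with h2 | h2
    · obtain ⟨r, rfl⟩ := Nat.exists_eq_add_of_le h1.le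
      rw [h.iterate_left hz (by omega)] at ht
      exact absurd ht.1 (not_le.2 (h.left_neg (by omega) (by omega)))
    · obtain ⟨r, rfl⟩ := Nat.exists_eq_add_of_le h2
      rw [h.iterate_back hz (by omega)] at ht
      have := ht.2
      simp only [rightPt] at this
      omega

lemma firstReturn_eq (h : IsTurn α β z n m) (hz : 0 ≤ z) :
    firstReturn α β (z, 0) = (z + (m + n) * (α * (m - n) + 2 * β), 0) := by
  rw [firstReturn, h.returnTime_eq hz, h.iterate_eq hz]

end IsTurn

/-! ### Exit height and exit distance, and the rotation of the residue -/

/-- The point of the axis `y = 0` whose orbit first has `x < 0` at the point `(-s, -n)`. -/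
def rayPt (α β : ℕ) (n s : ℤ) : ℤ × ℤ := (α * tri n - β * n - s, 0)

lemma rayPt_mem {n s : ℤ} (hβ : β < α) (hn : 0 < n) (hs : s ≤ α * n - β) :
    0 ≤ α * tri n - β * n - s := by
  obtain ⟨m, rfl⟩ : ∃ m, n = m + 1 := ⟨n - 1, by ring⟩
  have h1 := two_mul_tri (m + 1)
  have h2 : (β : ℤ) + 1 ≤ α := by exact_mod_cast hβ
  rcases (show m = 0 ∨ 1 ≤ m by omega) with rfl | h
  · norm_num [tri] at *
    linarith
  · have h3 : (0 : ℤ) ≤ α * (m * (m - 1)) :=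
      mul_nonneg (by positivity) (mul_nonneg (by omega) (by omega))
    nlinarith

/-- The exit height and the exit distance are determined by the point: at exit height `n` the
points fill an interval of length `αn - β`, and these intervals are disjoint. -/
lemma rayPt_inj {n s n' s' : ℤ} (hβ : β < α) (hn : 0 < n) (hn' : 0 < n')
    (hs : 0 < s) (hs' : 0 < s') (hsn : s ≤ α * n - β) (hsn' : s' ≤ α * n' - β)
    (h : rayPt α β n s = rayPt α β n' s') : n = n' ∧ s = s' := by
  have h0 : (β : ℤ) + 1 ≤ α := by exact_mod_cast hβ
  have key : ∀ {n s n' s' : ℤ}, 0 < n → 0 < s → s' ≤ α * n' - β →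
      α * tri n - β * n - s = α * tri n' - β * n' - s' → ¬ n < n' := by
    intro n s n' s' hn hs hs' h hlt
    have h1 := two_mul_tri n
    have h2 := two_mul_tri n'
    obtain ⟨d, rfl⟩ : ∃ d, n' = n + 1 + d := ⟨n' - n - 1, by ring⟩
    have e1 : (0 : ℤ) ≤ α * (d * (2 * n + d - 1)) := by
      rcases (show d = 0 ∨ 1 ≤ d by omega) with rfl | hd
      · simp
      · exact mul_nonneg (by positivity) (mul_nonneg (by omega) (by omega))
    have e2 : (0 : ℤ) ≤ (α - β) * d := mul_nonneg (by omega) (by omega)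
    nlinarith
  simp only [rayPt, Prod.mk.injEq, and_true] at h
  have : n = n' := le_antisymm (not_lt.1 (key hn' hs' hsn h.symm)) (not_lt.1 (key hn hs hsn' h))
  subst this
  exact ⟨rfl, by linarith⟩

lemma exists_rayPt (hβ : β < α) {z : ℤ} (hz : 0 ≤ z) :
    ∃ n s : ℤ, 0 < n ∧ 0 < s ∧ s ≤ α * n - β ∧ (z, 0) = rayPt α β n s := by
  have h0 : (β : ℤ) + 1 ≤ α := by exact_mod_cast hβ
  have hstep : ∀ n : ℤ, α * tri (n + 1) - β * (n + 1) = α * tri n - β * n + (α * (n + 1) - β) := by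
    intro n
    have h1 := two_mul_tri n
    have h2 := two_mul_tri (n + 1)
    rw [show tri (n + 1) = tri n + (n + 1) by linarith]
    ring
  have hgrow : ∀ n : ℕ, (n : ℤ) ≤ α * tri n - β * n := by
    intro n
    induction n with
    | zero => simp [tri]
    | succ n ih =>
      push_cast
      rw [hstep]
      nlinarith
  have hex : ∃ n : ℕ, z < α * tri n - β * n :=
    ⟨(z + 1).toNat, lt_of_lt_of_le (by omega) (hgrow _)⟩
  classical
  have h1 := Nat.find_spec hex
  rcases hN : Nat.find hex with _ | n
  · rw [hN] at h1
    simp [tri] at h1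
    omega
  · rw [hN] at h1
    have h2 := Nat.find_min hex (show n < Nat.find hex by omega)
    push_cast at h1
    refine ⟨n + 1, α * tri (n + 1) - β * (n + 1) - z, by omega, by linarith, ?_, ?_⟩
    · have := hstep n
      linarith
    · simp [rayPt]

/-- The exit distance `s` and height `n` determine the next turn. After the half turn in `x < 0`,
the orbit enters `0 ≤ x` at `(αm + β - v, m)`. -/
lemma isTurn_rayPt {n m : ℕ} {j s v : ℤ} (hn : 0 < n) (hm : 0 < m) (hj : (m : ℤ) = n - j)
    (hv : v = s - (2 * β - α * j) * n + (β * (1 + j) - α * tri j))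
    (hs : 0 < s) (hsn : s ≤ α * n - β) (hv0 : 0 < v) (hvm : v ≤ α * m + β) :
    IsTurn α β (α * tri n - β * n - s) n m := by
  have t1 := two_mul_tri n
  have t2 := two_mul_tri (-n)
  have t3 := two_mul_tri (-n - 1)
  have t4 := two_mul_tri m
  have t5 := two_mul_tri (m - 1)
  have t6 := two_mul_tri j
  have u1 : tri (-n - 1) = tri n := by linarith
  have u2 : tri (-n) = tri n - n := by linarith
  have u3 : tri ((m : ℤ) - 1) = tri m - m := by linarith
  have key : (α * tri n - β * n - s) - α * (n : ℤ) ^ 2 + 2 * β * n + α * tri m + β * m =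
      α * m + β - v := by
    rw [hj] at t4 ⊢
    rw [hv]
    have : (2 : ℤ) * ((α * tri n - β * n - s) - α * (n : ℤ) ^ 2 + 2 * β * n + α * tri (n - j)
        + β * (n - j)) = 2 * (α * (n - j) + β -
        (s - (2 * β - α * j) * n + (β * (1 + j) - α * tri j))) := by
      linear_combination (α : ℤ) * t1 + α * t4 - α * t6
    linarith
  refine ⟨hn, hm, ?_, ?_, ?_, ?_⟩
  · simp only [rightPt, add_sub_cancel_right, u2]
    linarith
  · simp only [rightPt, u1]
    linarith
  · simp only [leftPt, u3]
    linarith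
  · simp only [leftPt]
    linarith

lemma next_rayPt {n m n' j s v j' s' : ℤ} (hj : m = n - j) (hj' : n' = m + j')
    (hv : v = s - (2 * β - α * j) * n + (β * (1 + j) - α * tri j))
    (hs' : s' = v - (2 * β - α * j') * m - (β * (1 + j') - α * tri j')) :
    (α * tri n - β * n - s) + (m + n) * (α * (m - n) + 2 * β) = α * tri n' - β * n' - s' := by
  subst hj hj' hv hs'
  have t1 := two_mul_tri n
  have t2 := two_mul_tri j
  have t3 := two_mul_tri j'
  have t4 := two_mul_tri (n - j + j')
  have : 2 * ((α * tri n - β * n - s) + (n - j + n) * (α * (n - j - n) + 2 * β)) =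
      2 * (α * tri (n - j + j') - β * (n - j + j') - (s - (2 * β - α * j) * n +
        (β * (1 + j) - α * tri j) - (2 * β - α * j') * (n - j) - (β * (1 + j') - α * tri j'))) := by
    linear_combination (α : ℤ) * t1 - α * t4 + α * t3 - α * t2
  linarith

/-- `gcd(α, 2β)`: exit distances at height `n` are read in units of `gcd(α, 2β) n`. -/
def gcdUnit (α β : ℕ) : ℕ := Nat.gcd α (2 * β)

/-- `2β / gcd(α, 2β)`: each half turn is a rotation of `ℤ / alphaBar` by this number. -/
def rotNum (α β : ℕ) : ℕ := 2 * β / Nat.gcd α (2 * β)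

lemma gcdUnit_mul_alphaBar : gcdUnit α β * alphaBar α β = α :=
  Nat.mul_div_cancel' (Nat.gcd_dvd_left _ _)

lemma gcdUnit_mul_rotNum : gcdUnit α β * rotNum α β = 2 * β :=
  Nat.mul_div_cancel' (Nat.gcd_dvd_right _ _)

lemma gcdUnit_pos (hβ : β < α) : 0 < gcdUnit α β := Nat.gcd_pos_of_pos_left _ (by omega)

lemma alphaBar_pos (hβ : β < α) : 0 < alphaBar α β := by
  by_contra h
  have := gcdUnit_mul_alphaBar (α := α) (β := β)
  rw [Nat.eq_zero_of_not_pos h] at this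
  omega

lemma coprime_rotNum (hβ : β < α) : Nat.Coprime (alphaBar α β) (rotNum α β) :=
  Nat.coprime_div_gcd_div_gcd (gcdUnit_pos hβ)

lemma rotNum_lt (hβ : β < α) : rotNum α β < 2 * alphaBar α β := by
  have h1 := gcdUnit_mul_alphaBar (α := α) (β := β)
  have h2 := gcdUnit_mul_rotNum (α := α) (β := β)
  have h3 : gcdUnit α β * rotNum α β < gcdUnit α β * (2 * alphaBar α β) := by linarith
  exact lt_of_mul_lt_mul_left h3 (Nat.zero_le _)

/-- The residue modulo `alphaBar` after `k` half turns. -/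
def rot (α β : ℕ) (ρ : ℤ) (k : ℕ) : ℤ := (ρ - rotNum α β * k) % alphaBar α β

/-- The number of times the `k`-th half turn wraps around modulo `alphaBar`; up to the alternating
sign this is the change of height in that half turn. -/
def wrap (α β : ℕ) (ρ : ℤ) (k : ℕ) : ℤ :=
  (rot α β ρ (k + 1) - rot α β ρ k + rotNum α β) / alphaBar α β

/-- The height `|y|` of the crossing after `k` half turns, from an orbit that exits at height `n`. -/
def height (α β : ℕ) (ρ n : ℤ) (k : ℕ) : ℤ :=
  n - ∑ i ∈ Finset.range k, (-1) ^ i * wrap α β ρ i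

/-- The change of the remainder of the distance modulo `gcdUnit * height` in the `k`-th half turn,
up to the alternating sign. -/
def driftTerm (α β : ℕ) (ρ : ℤ) (k : ℕ) : ℤ :=
  β * (1 + wrap α β ρ k) - α * tri (wrap α β ρ k) +
    gcdUnit α β * rot α β ρ (k + 1) * wrap α β ρ k

/-- The accumulated change of the remainder of the distance in `k` half turns. -/
def drift (α β : ℕ) (ρ : ℤ) (k : ℕ) : ℤ :=
  ∑ i ∈ Finset.range k, (-1) ^ i * driftTerm α β ρ i

/-- The distance at the end of `k` half turns, if the orbit stays away from the discontinuities. For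
even `k` it is the exit distance `s` in `(-s, -n)`, where `n` is the height; for odd `k` it is the
`v` in the entry point `(αm + β - v, m)`, where `m` is the height. -/
def crossingDist (α β : ℕ) (ρ n e : ℤ) (k : ℕ) : ℤ :=
  rot α β ρ k * gcdUnit α β * height α β ρ n k + e + drift α β ρ k

lemma rot_nonneg (hβ : β < α) (ρ : ℤ) (k : ℕ) : 0 ≤ rot α β ρ k :=
  Int.emod_nonneg _ (by have := alphaBar_pos hβ; omega)

lemma rot_lt (hβ : β < α) (ρ : ℤ) (k : ℕ) : rot α β ρ k < alphaBar α β :=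
  Int.emod_lt_of_pos _ (by have := alphaBar_pos hβ; omega)

lemma mul_wrap (α β : ℕ) (ρ : ℤ) (k : ℕ) : alphaBar α β * wrap α β ρ k =
    rot α β ρ (k + 1) - rot α β ρ k + rotNum α β := by
  refine Int.mul_ediv_cancel' (Int.dvd_of_emod_eq_zero ?_)
  rw [rot, rot, Int.add_emod, Int.emod_sub_emod, Int.sub_emod_emod, ← Int.add_emod]
  push_cast
  ring_nf
  simp

lemma wrap_nonneg (hβ : β < α) (ρ : ℤ) (k : ℕ) : 0 ≤ wrap α β ρ k := by
  have h1 := mul_wrap α β ρ k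
  have h2 := rot_nonneg hβ ρ (k + 1)
  have h3 := rot_lt hβ ρ k
  by_contra! h
  have : (0 : ℤ) ≤ alphaBar α β * (-1 - wrap α β ρ k) := mul_nonneg (by positivity) (by omega)
  nlinarith

lemma wrap_le (hβ : β < α) (ρ : ℤ) (k : ℕ) : wrap α β ρ k ≤ 2 := by
  have h1 := mul_wrap α β ρ k
  have h2 := rot_lt hβ ρ (k + 1)
  have h3 := rot_nonneg hβ ρ k
  have h4 : (rotNum α β : ℤ) < 2 * alphaBar α β := by exact_mod_cast rotNum_lt hβ
  by_contra! h
  have : (0 : ℤ) ≤ alphaBar α β * (wrap α β ρ k - 3) := mul_nonneg (by positivity) (by omega)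
  nlinarith

lemma two_mul_driftTerm (α β : ℕ) (ρ : ℤ) (k : ℕ) : 2 * driftTerm α β ρ k = gcdUnit α β *
    (rot α β ρ k - rot α β ρ (k + 1) +
      wrap α β ρ k * (rot α β ρ k + rot α β ρ (k + 1))) := by
  have h1 := mul_wrap α β ρ k
  have h2 : (gcdUnit α β : ℤ) * alphaBar α β = α := by exact_mod_cast gcdUnit_mul_alphaBar
  have h3 : (gcdUnit α β : ℤ) * rotNum α β = 2 * β := by exact_mod_cast gcdUnit_mul_rotNum
  have h4 := two_mul_tri (wrap α β ρ k)
  rw [driftTerm]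
  linear_combination (-(α : ℤ)) * h4 - (1 + wrap α β ρ k) * h3 +
    (wrap α β ρ k * (wrap α β ρ k + 1)) * h2 - gcdUnit α β * (1 + wrap α β ρ k) * h1

lemma abs_driftTerm_le (hβ : β < α) (ρ : ℤ) (k : ℕ) : |driftTerm α β ρ k| ≤ 3 * α := by
  have h1 := two_mul_driftTerm α β ρ k
  have h2 : (gcdUnit α β : ℤ) * alphaBar α β = α := by exact_mod_cast gcdUnit_mul_alphaBar
  have r0 := rot_nonneg hβ ρ k
  have r1 := rot_lt hβ ρ k
  have s0 := rot_nonneg hβ ρ (k + 1)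
  have s1 := rot_lt hβ ρ (k + 1)
  have w0 := wrap_nonneg hβ ρ k
  have w2 := wrap_le hβ ρ k
  have u0 : (0 : ℤ) ≤ gcdUnit α β := by positivity
  set W := wrap α β ρ k
  set R := rot α β ρ k
  set S := rot α β ρ (k + 1)
  have e1 : W * (R + S) ≤ 2 * (R + S) := mul_le_mul_of_nonneg_right w2 (by omega)
  have e0 : 0 ≤ W * (R + S) := mul_nonneg w0 (by omega)
  have f1 : (gcdUnit α β : ℤ) * (R - S + W * (R + S)) ≤ gcdUnit α β * (6 * alphaBar α β) :=
    mul_le_mul_of_nonneg_left (by linarith) u0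
  have f2 : (gcdUnit α β : ℤ) * (-(6 * alphaBar α β)) ≤ gcdUnit α β * (R - S + W * (R + S)) :=
    mul_le_mul_of_nonneg_left (by linarith) u0
  rw [abs_le]
  constructor <;> nlinarith

lemma abs_alternating_sum_le {f : ℕ → ℤ} {c : ℤ} (hf : ∀ i, |f i| ≤ c) (k : ℕ) :
    |∑ i ∈ Finset.range k, (-1) ^ i * f i| ≤ c * k := by
  refine (Finset.abs_sum_le_sum_abs _ _).trans ?_
  refine (Finset.sum_le_card_nsmul _ _ c fun i _ => ?_).trans ?_
  · simpa [abs_mul] using hf i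
  · simp [mul_comm]

lemma crossingDist_succ (α β : ℕ) (ρ n e : ℤ) (k : ℕ) :
    crossingDist α β ρ n e (k + 1) =
    crossingDist α β ρ n e k - (2 * β - α * wrap α β ρ k) * height α β ρ n k +
      (-1) ^ k * (β * (1 + wrap α β ρ k) - α * tri (wrap α β ρ k)) := by
  have h1 := mul_wrap α β ρ k
  have h2 : (gcdUnit α β : ℤ) * alphaBar α β = α := by exact_mod_cast gcdUnit_mul_alphaBar
  have h3 : (gcdUnit α β : ℤ) * rotNum α β = 2 * β := by exact_mod_cast gcdUnit_mul_rotNum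
  rw [crossingDist, crossingDist, drift, drift, height, height, Finset.sum_range_succ,
    Finset.sum_range_succ, driftTerm]
  set H := n - ∑ i ∈ Finset.range k, (-1) ^ i * wrap α β ρ i with hH
  linear_combination (-H * gcdUnit α β) * h1 - H * h3 + H * wrap α β ρ k * h2
lemma height_succ (ρ n : ℤ) (k : ℕ) :
    height α β ρ n (k + 1) = height α β ρ n k - (-1) ^ k * wrap α β ρ k := by
  rw [height, height, Finset.sum_range_succ]
  ring

/-- The point of the ray with exit height `n` and exit distance `ρ · gcd(α, 2β) · n + e`. -/
def site (α β : ℕ) (ρ n e : ℤ) : ℤ × ℤ := rayPt α β n (ρ * gcdUnit α β * n + e)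

/-- The point `site α β ρ n e` lies so far from the discontinuities of the half turns that the first
`2 * alphaBar` half turns act as rotations on its residue `ρ`. The constant `20 α²` exceeds all
displacements that occur in that time. -/
structure IsDeep (α β : ℕ) (ρ n e : ℤ) : Prop where
  nonneg : 0 ≤ ρ
  lt : ρ < alphaBar α β
  le : 20 * (α : ℤ) ^ 2 ≤ e
  add_le : e + 20 * (α : ℤ) ^ 2 ≤ gcdUnit α β * n

namespace IsDeep
variable {ρ n e : ℤ}

lemma bounds (h : IsDeep α β ρ n e) (hβ : β < α) {k : ℕ} (hk : k ≤ 2 * alphaBar α β) :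
    0 < height α β ρ n k ∧ 0 < crossingDist α β ρ n e k ∧
      crossingDist α β ρ n e k ≤ α * height α β ρ n k - β ∧
      0 < e + drift α β ρ k ∧ e + drift α β ρ k < gcdUnit α β * height α β ρ n k := by
  have h2 : (gcdUnit α β : ℤ) * alphaBar α β = α := by exact_mod_cast gcdUnit_mul_alphaBar
  have hA : (1 : ℤ) ≤ alphaBar α β := by exact_mod_cast alphaBar_pos hβ
  have hU : (1 : ℤ) ≤ gcdUnit α β := by exact_mod_cast gcdUnit_pos hβ
  have hβ' : (β : ℤ) < α := by exact_mod_cast hβ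
  have hk' : (k : ℤ) ≤ 2 * alphaBar α β := by exact_mod_cast hk
  have hAα : (alphaBar α β : ℤ) ≤ α := by nlinarith
  have w := abs_alternating_sum_le (f := wrap α β ρ) (c := 2)
    (fun i => by rw [abs_of_nonneg (wrap_nonneg hβ ρ i)]; exact wrap_le hβ ρ i) k
  have d := abs_alternating_sum_le (abs_driftTerm_le hβ ρ) k
  rw [← drift] at d
  have hh : height α β ρ n k = n - ∑ i ∈ Finset.range k, (-1) ^ i * wrap α β ρ i := rfl
  have hle := h.le
  have hadd := h.add_le
  obtain ⟨w1, w2⟩ := abs_le.1 w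
  obtain ⟨d1, d2⟩ := abs_le.1 d
  have h3 : (3 * α : ℤ) * k ≤ 6 * α ^ 2 := by nlinarith
  have hn : 40 * α * alphaBar α β ≤ n := by
    have : (gcdUnit α β : ℤ) * (40 * α * alphaBar α β) ≤ gcdUnit α β * n := by nlinarith
    exact le_of_mul_le_mul_left this (by omega)
  have hn' : 40 * (alphaBar α β : ℤ) ≤ n := by nlinarith
  have hH : 0 < height α β ρ n k := by
    rw [hh]
    linarith
  have h4 : (gcdUnit α β : ℤ) * (n - height α β ρ n k) ≤ 4 * α :=
    calc (gcdUnit α β : ℤ) * (n - height α β ρ n k) ≤ gcdUnit α β * (4 * alphaBar α β) :=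
          mul_le_mul_of_nonneg_left (by rw [hh]; linarith) (by omega)
      _ = 4 * α := by rw [← h2]; ring
  have h5 : (α : ℤ) ≤ α ^ 2 := by nlinarith
  have h6 : 0 < e + drift α β ρ k := by nlinarith
  have h7 : e + drift α β ρ k + β ≤ gcdUnit α β * height α β ρ n k := by nlinarith
  have h8 : e + drift α β ρ k < gcdUnit α β * height α β ρ n k := by nlinarith
  have r0 := rot_nonneg hβ ρ k
  have r1 := rot_lt hβ ρ k
  have hUH : 0 ≤ gcdUnit α β * height α β ρ n k := by positivity
  refine ⟨hH, ?_, ?_, h6, h8⟩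
  · have : 0 ≤ rot α β ρ k * (gcdUnit α β * height α β ρ n k) := mul_nonneg r0 hUH
    rw [crossingDist]
    linarith
  · have : rot α β ρ k * (gcdUnit α β * height α β ρ n k) ≤
        (alphaBar α β - 1) * (gcdUnit α β * height α β ρ n k) :=
      mul_le_mul_of_nonneg_right (by omega) hUH
    rw [crossingDist, ← h2]
    linarith

lemma rot_zero (h : IsDeep α β ρ n e) : rot α β ρ 0 = ρ := by
  simp [rot, Int.emod_eq_of_lt h.nonneg h.lt]

lemma rayPt_zero (h : IsDeep α β ρ n e) :
    rayPt α β (height α β ρ n 0) (crossingDist α β ρ n e 0) = site α β ρ n e := by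
  simp [site, crossingDist, height, drift, h.rot_zero]

lemma turn (h : IsDeep α β ρ n e) (hβ : β < α) {l : ℕ} (hl : l < alphaBar α β) :
    firstReturn α β (rayPt α β (height α β ρ n (2 * l)) (crossingDist α β ρ n e (2 * l))) =
        rayPt α β (height α β ρ n (2 * (l + 1))) (crossingDist α β ρ n e (2 * (l + 1))) ∧
      ∃ t, 0 < t ∧
        (latticeMap α β)^[t] (rayPt α β (height α β ρ n (2 * l)) (crossingDist α β ρ n e (2 * l))) =
        rayPt α β (height α β ρ n (2 * (l + 1))) (crossingDist α β ρ n e (2 * (l + 1))) := by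
  obtain ⟨a1, a2, a3, -⟩ := h.bounds hβ (k := 2 * l) (by omega)
  obtain ⟨b1, b2, b3, -⟩ := h.bounds hβ (k := 2 * l + 1) (by omega)
  have hz := rayPt_mem hβ a1 a3
  have e1 := height_succ (α := α) (β := β) ρ n (2 * l)
  have e2 := height_succ (α := α) (β := β) ρ n (2 * l + 1)
  have e3 := crossingDist_succ α β ρ n e (2 * l)
  have e4 := crossingDist_succ α β ρ n e (2 * l + 1)
  rw [pow_succ, pow_mul, neg_one_sq, one_pow] at e2 e4
  rw [pow_mul, neg_one_sq, one_pow] at e1 e3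
  have key := next_rayPt (α := α) (β := β) (n := height α β ρ n (2 * l))
    (m := height α β ρ n (2 * l + 1)) (n' := height α β ρ n (2 * l + 1 + 1))
    (j := wrap α β ρ (2 * l)) (j' := wrap α β ρ (2 * l + 1))
    (s := crossingDist α β ρ n e (2 * l)) (v := crossingDist α β ρ n e (2 * l + 1))
    (s' := crossingDist α β ρ n e (2 * l + 1 + 1))
    (by linarith) (by linarith) (by linarith) (by linarith)
  have hturn := isTurn_rayPt (α := α) (β := β) (n := (height α β ρ n (2 * l)).toNat)
    (m := (height α β ρ n (2 * l + 1)).toNat) (j := wrap α β ρ (2 * l))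
    (s := crossingDist α β ρ n e (2 * l)) (v := crossingDist α β ρ n e (2 * l + 1))
    (by omega) (by omega)
    (by rw [Int.toNat_of_nonneg b1.le, Int.toNat_of_nonneg a1.le]; linarith)
    (by rw [Int.toNat_of_nonneg a1.le]; linarith) a2
    (by rw [Int.toNat_of_nonneg a1.le]; exact a3) b2
    (by rw [Int.toNat_of_nonneg b1.le]; linarith)
  rw [Int.toNat_of_nonneg a1.le] at hturn
  have f1 := hturn.firstReturn_eq hz
  have f2 := hturn.iterate_eq hz
  rw [Int.toNat_of_nonneg a1.le, Int.toNat_of_nonneg b1.le, key] at f1 f2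
  exact ⟨f1, _, by omega, f2⟩

lemma iterate (h : IsDeep α β ρ n e) (hβ : β < α) {l : ℕ} (hl : l ≤ alphaBar α β) :
    (firstReturn α β)^[l] (site α β ρ n e) =
        rayPt α β (height α β ρ n (2 * l)) (crossingDist α β ρ n e (2 * l)) ∧
      ∃ t, l ≤ t ∧ (latticeMap α β)^[t] (site α β ρ n e) =
        rayPt α β (height α β ρ n (2 * l)) (crossingDist α β ρ n e (2 * l)) := by
  induction l with
  | zero => exact ⟨h.rayPt_zero.symm, 0, le_rfl, h.rayPt_zero.symm⟩
  | succ l ih =>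
    obtain ⟨h1, t, ht, h2⟩ := ih (by omega)
    obtain ⟨h3, r, hr, h4⟩ := h.turn hβ (show l < alphaBar α β by omega)
    refine ⟨by rw [Function.iterate_succ_apply', h1, h3], r + t, by omega, ?_⟩
    rw [Function.iterate_add_apply, h2, h4]

end IsDeep

/-! ### Periodic return map for odd `alphaBar`, infinite orbits for even `alphaBar` -/

lemma alternating_sum_eq_zero {f : ℕ → ℤ} {A : ℕ} (hA : Odd A) (hf : ∀ i, f (A + i) = f i) :
    ∑ i ∈ Finset.range (2 * A), (-1) ^ i * f i = 0 := by
  rw [two_mul, Finset.sum_range_add, ← Finset.sum_add_distrib]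
  refine Finset.sum_eq_zero fun i _ => ?_
  rw [hf, pow_add, hA.neg_one_pow]
  ring

lemma alternating_sum_telescope (f : ℕ → ℤ) (k : ℕ) :
    ∑ i ∈ Finset.range k, (-1) ^ i * (f i + f (i + 1)) = f 0 - (-1) ^ k * f k := by
  induction k with
  | zero => simp
  | succ k ih =>
    rw [Finset.sum_range_succ, ih]
    ring

lemma alternating_sum_telescope_eq_zero {f : ℕ → ℤ} {A : ℕ} (hA : Even A) (hf : f A = f 0) :
    ∑ i ∈ Finset.range A, (-1) ^ i * (f i + f (i + 1)) = 0 := by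
  rw [alternating_sum_telescope, hA.neg_one_pow, hf]
  ring

lemma rot_alphaBar_add (ρ : ℤ) (k : ℕ) : rot α β ρ (alphaBar α β + k) = rot α β ρ k := by
  rw [rot, rot]
  push_cast
  rw [show ρ - rotNum α β * (alphaBar α β + k : ℤ) =
    ρ - rotNum α β * k + alphaBar α β * (-rotNum α β) by ring, Int.add_mul_emod_self_left]

lemma wrap_alphaBar_add (ρ : ℤ) (k : ℕ) : wrap α β ρ (alphaBar α β + k) = wrap α β ρ k := by
  rw [wrap, wrap, add_assoc, rot_alphaBar_add, rot_alphaBar_add]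

lemma driftTerm_alphaBar_add (ρ : ℤ) (k : ℕ) :
    driftTerm α β ρ (alphaBar α β + k) = driftTerm α β ρ k := by
  rw [driftTerm, driftTerm, add_assoc, rot_alphaBar_add, wrap_alphaBar_add]

lemma eq_of_rot_eq (hβ : β < α) {ρ : ℤ} {k l : ℕ} (h : rot α β ρ k = rot α β ρ l) :
    (alphaBar α β : ℤ) ∣ l - k := by
  have h2 : (alphaBar α β : ℤ) ∣ rotNum α β * (l - k) := by
    have := Int.ModEq.dvd (n := alphaBar α β) h.symm
    rwa [show ρ - rotNum α β * (k : ℤ) - (ρ - rotNum α β * l) = rotNum α β * (l - k) by ring]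
      at this
  exact (Nat.isCoprime_iff_coprime.2 (coprime_rotNum hβ)).dvd_of_dvd_mul_left h2

namespace IsDeep
variable {ρ n e : ℤ}

/-- For odd `alphaBar` the alternating sums over `2 * alphaBar` half turns cancel in pairs, so that
the return map has the exact period `alphaBar` at a deep point. -/
lemma isPeriodic_of_odd (h : IsDeep α β ρ n e) (hβ : β < α) (hodd : Odd (alphaBar α β)) :
    Function.minimalPeriod (firstReturn α β) (site α β ρ n e) = alphaBar α β ∧
      IsPeriodicPoint α β (site α β ρ n e) := by
  have hA := alphaBar_pos hβ
  have hrot : rot α β ρ (2 * alphaBar α β) = ρ := by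
    rw [two_mul, rot_alphaBar_add, ← add_zero (alphaBar α β), rot_alphaBar_add, h.rot_zero]
  have hclosed : rayPt α β (height α β ρ n (2 * alphaBar α β))
      (crossingDist α β ρ n e (2 * alphaBar α β)) = site α β ρ n e := by
    rw [crossingDist, drift, height, alternating_sum_eq_zero hodd (wrap_alphaBar_add ρ),
      alternating_sum_eq_zero hodd (driftTerm_alphaBar_add ρ), hrot]
    simp [site]
  obtain ⟨h1, t, ht, h2⟩ := h.iterate hβ le_rfl
  rw [hclosed] at h1 h2
  have hper : Function.IsPeriodicPt (firstReturn α β) (alphaBar α β) (site α β ρ n e) := h1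
  refine ⟨?_, t, by omega, h2⟩
  by_contra hne
  have hlt := lt_of_le_of_ne (hper.minimalPeriod_le hA) hne
  have hpos := hper.minimalPeriod_pos hA
  have hmin := Function.isPeriodicPt_minimalPeriod (firstReturn α β) (site α β ρ n e)
  set d := Function.minimalPeriod (firstReturn α β) (site α β ρ n e) with hd
  have h3 := (h.iterate hβ hlt.le).1
  rw [hmin.eq, ← h.rayPt_zero] at h3
  obtain ⟨a1, a2, a3, a4, a5⟩ := h.bounds hβ (k := 0) (by omega)
  obtain ⟨b1, b2, b3, b4, b5⟩ := h.bounds hβ (k := 2 * d) (by omega)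
  obtain ⟨e1, e2⟩ := rayPt_inj hβ a1 b1 a2 b2 a3 b3 h3
  -- The remainders lie in `(0, gcd(α, 2β) n)`, so that the distance determines the residue.
  have hU : (0 : ℤ) < gcdUnit α β := by exact_mod_cast gcdUnit_pos hβ
  have hdiv : ∀ {r f : ℤ}, 0 < f → f < gcdUnit α β * height α β ρ n 0 →
      (r * gcdUnit α β * height α β ρ n 0 + f) / (gcdUnit α β * height α β ρ n 0) = r := by
    intro r f hf0 hf1
    rw [mul_assoc, add_comm, Int.add_mul_ediv_right _ _ (by positivity),
      Int.ediv_eq_zero_of_lt hf0.le hf1, zero_add]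
  have h4 : rot α β ρ 0 = rot α β ρ (2 * d) := by
    rw [← hdiv (r := rot α β ρ 0) a4 a5, ← hdiv (r := rot α β ρ (2 * d)) b4 (by rw [e1]; exact b5),
      ← add_assoc, ← add_assoc]
    have : crossingDist α β ρ n e 0 = rot α β ρ (2 * d) * gcdUnit α β * height α β ρ n 0 + e +
        drift α β ρ (2 * d) := by rw [e2, e1, crossingDist]
    rw [← this, crossingDist]
  have h5 : alphaBar α β ∣ 2 * d := by
    have := eq_of_rot_eq hβ h4
    exact_mod_cast (by simpa using this : (alphaBar α β : ℤ) ∣ ((2 * d : ℕ) : ℤ))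
  have h6 : alphaBar α β ∣ d := (Nat.coprime_two_right.2 hodd).dvd_of_dvd_mul_left h5
  exact absurd (Nat.le_of_dvd hpos h6) (by omega)

end IsDeep

lemma neg_one_pow_rot (hβ : β < α) {ρ : ℤ} (heven : Even (alphaBar α β)) (k : ℕ) :
    (-1 : ℤ) ^ k = (-1) ^ (rot α β ρ 0).toNat * (-1) ^ (rot α β ρ k).toNat := by
  have hodd : Odd (rotNum α β) := by
    rw [← Nat.not_even_iff_odd]
    intro h
    have := Nat.dvd_gcd heven.two_dvd h.two_dvd
    rw [coprime_rotNum hβ] at this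
    omega
  have h0 := rot_nonneg hβ ρ 0
  have h1 := rot_nonneg hβ ρ k
  have hpar : Even ((rot α β ρ 0 + rot α β ρ k) + k) := by
    have e1 : Even (rot α β ρ 0 - ρ) := by
      have : (alphaBar α β : ℤ) ∣ (ρ - rotNum α β * (0 : ℕ)) - rot α β ρ 0 :=
        Int.dvd_self_sub_emod
      rw [← even_neg]
      have h3 := (even_iff_two_dvd.1 ((Int.even_coe_nat _).2 heven)).trans this
      rw [even_iff_two_dvd]
      simpa using h3
    have e2 : Even (ρ - rotNum α β * k - rot α β ρ k) :=
      even_iff_two_dvd.2 <| (even_iff_two_dvd.1 ((Int.even_coe_nat _).2 heven)).trans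
        Int.dvd_self_sub_emod
    obtain ⟨a, ha⟩ := e1
    obtain ⟨b, hb⟩ := e2
    obtain ⟨c, hc⟩ := hodd
    rw [hc] at hb
    push_cast at hb
    exact ⟨a - b + ρ - c * k, by linarith⟩
  rw [← pow_add]
  have h2 : Even ((rot α β ρ 0).toNat + (rot α β ρ k).toNat + k) := by
    have : (((rot α β ρ 0).toNat + (rot α β ρ k).toNat + k : ℕ) : ℤ) =
        rot α β ρ 0 + rot α β ρ k + k := by
      push_cast
      rw [Int.toNat_of_nonneg h0, Int.toNat_of_nonneg h1]
    rw [← Int.even_coe_nat, this]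
    exact hpar
  rcases Nat.even_or_odd k with hk | hk
  · rw [hk.neg_one_pow, Even.neg_one_pow ((Nat.even_add.1 h2).2 hk)]
  · rw [hk.neg_one_pow, Odd.neg_one_pow]
    rw [← Nat.not_even_iff_odd] at hk ⊢
    exact fun hc => hk ((Nat.even_add.1 h2).1 hc)

/-- In `alphaBar` half turns every residue is visited once. As `alphaBar` is even, the parity of the
residue alternates. -/
lemma alternating_sum_rot (hβ : β < α) {ρ : ℤ} (heven : Even (alphaBar α β)) (ψ : ℤ → ℤ) :
    ∑ i ∈ Finset.range (alphaBar α β), (-1) ^ i * ψ (rot α β ρ i) =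
      (-1) ^ (rot α β ρ 0).toNat * ∑ x ∈ Finset.range (alphaBar α β), (-1) ^ x * ψ x := by
  have hinj : Set.InjOn (fun i => (rot α β ρ i).toNat)
      (Finset.range (alphaBar α β) : Set ℕ) := by
    intro k hk l hl hkl
    have h0 := rot_nonneg hβ ρ k
    have h1 := rot_nonneg hβ ρ l
    have h2 := eq_of_rot_eq hβ (show rot α β ρ k = rot α β ρ l by simp only at hkl; omega)
    simp only [Finset.coe_range, Set.mem_Iio] at hk hl
    have h3 := Int.eq_zero_of_abs_lt_dvd h2 (by rw [abs_lt]; omega)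
    omega
  have himg : (Finset.range (alphaBar α β)).image (fun i => (rot α β ρ i).toNat) =
      Finset.range (alphaBar α β) := by
    refine Finset.eq_of_subset_of_card_le ?_ (by rw [Finset.card_image_of_injOn hinj])
    intro x hx
    obtain ⟨i, -, rfl⟩ := Finset.mem_image.1 hx
    have := rot_lt hβ ρ i
    have := rot_nonneg hβ ρ i
    rw [Finset.mem_range]
    omega
  conv_rhs => rw [← himg, Finset.sum_image hinj, Finset.mul_sum]
  refine Finset.sum_congr rfl fun i _ => ?_
  rw [neg_one_pow_rot hβ (ρ := ρ) heven i, Int.toNat_of_nonneg (rot_nonneg hβ ρ i)]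
  ring

lemma alternating_sum_id (q : ℕ) : ∑ x ∈ Finset.range (2 * q), (-1) ^ x * (x : ℤ) = -(q : ℤ) := by
  induction q with
  | zero => simp
  | succ q ih =>
    rw [show 2 * (q + 1) = 2 * q + 1 + 1 by ring, Finset.sum_range_succ, Finset.sum_range_succ, ih,
      pow_succ (-1 : ℤ) (2 * q), (even_two_mul q).neg_one_pow]
    push_cast
    ring

lemma alternating_sum_sq (q : ℕ) :
    ∑ x ∈ Finset.range (2 * q), (-1) ^ x * (x : ℤ) ^ 2 = -(q : ℤ) * (2 * q - 1) := by
  induction q with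
  | zero => simp
  | succ q ih =>
    rw [show 2 * (q + 1) = 2 * q + 1 + 1 by ring, Finset.sum_range_succ, Finset.sum_range_succ, ih,
      pow_succ (-1 : ℤ) (2 * q), (even_two_mul q).neg_one_pow]
    push_cast
    ring

lemma height_alphaBar (hβ : β < α) {ρ : ℤ} (n : ℤ) (heven : Even (alphaBar α β)) :
    height α β ρ n (alphaBar α β) = n - (-1) ^ (rot α β ρ 0).toNat := by
  have hA : (0 : ℤ) < alphaBar α β := by exact_mod_cast alphaBar_pos hβ
  have hper : rot α β ρ (alphaBar α β) = rot α β ρ 0 := by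
    simpa using rot_alphaBar_add (α := α) (β := β) ρ 0
  have h1 := alternating_sum_telescope_eq_zero (f := rot α β ρ) heven hper
  have h2 := alternating_sum_telescope_eq_zero (f := fun _ => (rotNum α β : ℤ)) heven rfl
  have h3 := alternating_sum_rot hβ (ρ := ρ) heven (fun x => x)
  obtain ⟨q, hq⟩ := heven
  have h4 := alternating_sum_id q
  rw [two_mul, ← hq] at h4
  rw [h4] at h3
  rw [height]
  set s : ℤ := (-1) ^ (rot α β ρ 0).toNat
  have key : (2 * alphaBar α β : ℤ) *
      ∑ i ∈ Finset.range (alphaBar α β), (-1) ^ i * wrap α β ρ i = 2 * alphaBar α β * s := by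
    have : ∀ i, (2 * alphaBar α β : ℤ) * ((-1) ^ i * wrap α β ρ i) =
        2 * ((-1) ^ i * (rot α β ρ i + rot α β ρ (i + 1))) +
          (-1) ^ i * (rotNum α β + rotNum α β) - 4 * ((-1) ^ i * rot α β ρ i) := by
      intro i
      linear_combination (2 * (-1 : ℤ) ^ i) * mul_wrap α β ρ i
    rw [Finset.mul_sum, Finset.sum_congr rfl fun i _ => this i, Finset.sum_sub_distrib,
      Finset.sum_add_distrib, ← Finset.mul_sum, ← Finset.mul_sum, h1, h2, h3, hq]
    push_cast
    ring
  rw [mul_left_cancel₀ (by positivity) key]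

lemma two_mul_drift_alphaBar (hβ : β < α) {ρ : ℤ} (heven : Even (alphaBar α β)) :
    2 * drift α β ρ (alphaBar α β) = -(-1) ^ (rot α β ρ 0).toNat * gcdUnit α β := by
  have hA : (0 : ℤ) < alphaBar α β := by exact_mod_cast alphaBar_pos hβ
  have hper : rot α β ρ (alphaBar α β) = rot α β ρ 0 := by
    simpa using rot_alphaBar_add (α := α) (β := β) ρ 0
  have h1 := alternating_sum_telescope_eq_zero (f := rot α β ρ) heven hper
  have h2 := alternating_sum_telescope_eq_zero (f := fun i => rot α β ρ i ^ 2) heven (by rw [hper])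
  have h3 := alternating_sum_rot hβ (ρ := ρ) heven (fun x => x)
  have h4 := alternating_sum_rot hβ (ρ := ρ) heven (fun x => x ^ 2)
  obtain ⟨q, hq⟩ := heven
  have h5 := alternating_sum_id q
  have h6 := alternating_sum_sq q
  rw [two_mul, ← hq] at h5 h6
  rw [h5] at h3
  rw [h6] at h4
  set s : ℤ := (-1) ^ (rot α β ρ 0).toNat
  have key : (alphaBar α β : ℤ) * (2 * drift α β ρ (alphaBar α β)) =
      alphaBar α β * (-s * gcdUnit α β) := by
    have : ∀ i, (2 * alphaBar α β : ℤ) * ((-1) ^ i * driftTerm α β ρ i) =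
        gcdUnit α β * (rotNum α β - alphaBar α β) *
          ((-1) ^ i * (rot α β ρ i + rot α β ρ (i + 1))) +
        gcdUnit α β * ((-1) ^ i * (rot α β ρ i ^ 2 + rot α β ρ (i + 1) ^ 2)) +
        2 * gcdUnit α β * alphaBar α β * ((-1) ^ i * rot α β ρ i) -
        2 * gcdUnit α β * ((-1) ^ i * rot α β ρ i ^ 2) := by
      intro i
      linear_combination (alphaBar α β * (-1 : ℤ) ^ i) * two_mul_driftTerm α β ρ i +
        ((-1 : ℤ) ^ i * gcdUnit α β * (rot α β ρ i + rot α β ρ (i + 1))) * mul_wrap α β ρ i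
    rw [drift, ← mul_assoc, mul_comm _ (2 : ℤ), Finset.mul_sum,
      Finset.sum_congr rfl fun i _ => this i, Finset.sum_sub_distrib,
      Finset.sum_add_distrib, Finset.sum_add_distrib, ← Finset.mul_sum, ← Finset.mul_sum,
      ← Finset.mul_sum, ← Finset.mul_sum, h1, h2, h3, h4, hq]
    push_cast
    ring
  exact mul_left_cancel₀ (by positivity) key

namespace IsDeep
variable {ρ n e : ℤ}

/-- For even `alphaBar`, after `alphaBar` half turns a deep point has moved by one level, upwards if
its residue is odd and downwards if it is even, while `2e - gcd(α, 2β) n` is conserved. -/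
lemma iterate_of_even (h : IsDeep α β ρ n e) (hβ : β < α) (heven : Even (alphaBar α β)) :
    ∃ c : ℤ, 2 * c = gcdUnit α β ∧ ∃ t, (latticeMap α β)^[t] (site α β ρ n e) =
      site α β ρ (n - (-1) ^ ρ.toNat) (e - (-1) ^ ρ.toNat * c) := by
  have hh := height_alphaBar hβ (ρ := ρ) n heven
  have hd := two_mul_drift_alphaBar hβ (ρ := ρ) heven
  rw [h.rot_zero] at hh hd
  have hrot : rot α β ρ (alphaBar α β) = ρ := by
    rw [← add_zero (alphaBar α β), rot_alphaBar_add, h.rot_zero]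
  obtain ⟨q, hq⟩ := heven
  obtain ⟨-, t, -, ht⟩ := h.iterate hβ (l := q) (by omega)
  rw [two_mul, ← hq, crossingDist, hrot, hh] at ht
  have hs : ((-1 : ℤ) ^ ρ.toNat) * (-1) ^ ρ.toNat = 1 := by
    rw [← mul_pow]
    norm_num
  refine ⟨-(-1) ^ ρ.toNat * drift α β ρ (alphaBar α β), ?_, t, ?_⟩
  · linear_combination (-(-1 : ℤ) ^ ρ.toNat) * hd + gcdUnit α β * hs
  · rw [ht, site]
    congr 1
    linear_combination (-drift α β ρ (alphaBar α β)) * hs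

/-- For even `alphaBar` the orbit of a deep point contains points at all higher levels, in its future
or in its past. -/
lemma not_isPeriodicPoint (h : IsDeep α β ρ n e) (hβ : β < α) (heven : Even (alphaBar α β)) :
    ¬ IsPeriodicPoint α β (site α β ρ n e) := by
  obtain ⟨c, hc, -⟩ := h.iterate_of_even hβ heven
  have hdeep : ∀ k : ℕ, IsDeep α β ρ (n + k) (e + k * c) := by
    intro k
    have h1 := h.le
    have h2 := h.add_le
    have h3 : 0 ≤ k * c := mul_nonneg (by positivity) (by omega)
    exact ⟨h.nonneg, h.lt, by linarith, by nlinarith⟩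
  have hcycle : ∀ k : ℕ, (latticeMap α β).SameCycle (site α β ρ n e)
      (site α β ρ (n + k) (e + k * c)) := by
    intro k
    induction k with
    | zero => simpa using Equiv.Perm.SameCycle.refl _ _
    | succ k ih =>
      refine ih.trans ?_
      rcases neg_one_pow_eq_or ℤ ρ.toNat with hs | hs
      · obtain ⟨c', hc', t, ht⟩ := (hdeep (k + 1)).iterate_of_even hβ heven
        obtain rfl : c' = c := by omega
        rw [hs] at ht
        refine Equiv.Perm.SameCycle.symm ⟨t, ?_⟩
        rw [zpow_natCast, ← Equiv.Perm.iterate_eq_pow, ht]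
        push_cast
        congr 1 <;> ring
      · obtain ⟨c', hc', t, ht⟩ := (hdeep k).iterate_of_even hβ heven
        obtain rfl : c' = c := by omega
        rw [hs] at ht
        refine ⟨t, ?_⟩
        rw [zpow_natCast, ← Equiv.Perm.iterate_eq_pow, ht]
        push_cast
        congr 1 <;> ring
  have hinj : Function.Injective fun k : ℕ => site α β ρ (n + k) (e + k * c) := by
    intro k l hkl
    obtain ⟨a1, a2, a3, -⟩ := (hdeep k).bounds hβ (k := 0) (by omega)
    obtain ⟨b1, b2, b3, -⟩ := (hdeep l).bounds hβ (k := 0) (by omega)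
    have h1 : rayPt α β _ _ = rayPt α β _ _ :=
      ((hdeep k).rayPt_zero.trans hkl).trans (hdeep l).rayPt_zero.symm
    have h2 := (rayPt_inj hβ a1 b1 a2 b2 a3 b3 h1).1
    simp only [height, Finset.range_zero, Finset.sum_empty] at h2
    omega
  rintro ⟨P, hP, hper⟩
  refine Set.infinite_of_injective_forall_mem hinj (s := (fun i => (latticeMap α β)^[i]
    (site α β ρ n e)) '' (Set.Iio P)) (fun k => ?_) ((Set.finite_Iio P).image _)
  obtain ⟨i, hi⟩ := hcycle k
  have hfix : ((latticeMap α β) ^ (P : ℤ)) (site α β ρ n e) = site α β ρ n e := by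
    rw [zpow_natCast, ← Equiv.Perm.iterate_eq_pow]
    exact hper
  have hmod : 0 ≤ i % P := Int.emod_nonneg _ (by omega)
  refine ⟨(i % P).toNat, ?_, ?_⟩
  · have := Int.emod_lt_of_pos i (show (0 : ℤ) < P by omega)
    simp only [Set.mem_Iio]
    omega
  · rw [← hi]
    conv_rhs => rw [← Int.emod_add_mul_ediv i P, zpow_add, zpow_mul, Equiv.Perm.mul_apply,
      Equiv.Perm.zpow_apply_eq_self_of_apply_eq_self hfix]
    simp only
    rw [Equiv.Perm.iterate_eq_pow, ← zpow_natCast, Int.toNat_of_nonneg hmod]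

end IsDeep

/-- A sequence of distinct lattice points leaves every bounded set. -/
lemma tendsto_norm_iterate {f : ℤ × ℤ → ℤ × ℤ} (hf : Function.Injective f) {p : ℤ × ℤ}
    (hp : p ∉ Function.periodicPts f) : Tendsto (fun t : ℕ => ‖f^[t] p‖) atTop atTop := by
  have hinj : Function.Injective fun t : ℕ => f^[t] p := by
    intro a b hab
    by_contra hne
    wlog hlt : a < b generalizing a b
    · exact this hab.symm (Ne.symm hne) (by omega)
    refine hp ⟨b - a, by omega, ?_⟩
    refine hf.iterate a ?_
    rw [← Function.iterate_add_apply, Nat.add_sub_cancel' hlt.le]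
    exact hab.symm
  have h1 := hinj.tendsto_cofinite
  rw [Nat.cofinite_eq_atTop, ← Filter.cocompact_eq_cofinite] at h1
  exact (tendsto_norm_cocompact_atTop (E := ℤ × ℤ)).comp h1

lemma isEscapePoint_iff {p : ℤ × ℤ} : IsEscapePoint α β p ↔ ¬ IsPeriodicPoint α β p := by
  constructor
  · rintro ⟨h, -⟩ ⟨P, hP, hper⟩
    have h1 : Tendsto (fun k : ℕ => k * P) atTop atTop :=
      tendsto_id.atTop_mul_const' hP
    have h2 := h.comp h1
    refine not_tendsto_const_atTop ‖p‖ (atTop : Filter ℕ) (h2.congr fun k => ?_)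
    simp only [Function.comp_apply]
    rw [(hper.const_mul k).eq]
  · intro h
    refine ⟨tendsto_norm_iterate (latticeMap α β).injective h,
      tendsto_norm_iterate (latticeMap α β).symm.injective fun hp => h ?_⟩
    obtain ⟨P, hP, hper⟩ := hp
    refine ⟨P, hP, ?_⟩
    have h1 : (latticeMap α β)^[P] ((latticeMap α β).symm^[P] p) = p :=
      Function.LeftInverse.iterate (latticeMap α β).apply_symm_apply P p
    rwa [hper.eq] at h1

/-! ### Density on the ray and in the plane -/

lemma hasFullDensity_iff {X : Type*} {B : ℕ → Finset X} (hB : ∀ N, (B N).Nonempty) {S : Set X} :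
    HasFullDensity B S ↔
      ∀ ε : ℝ, 0 < ε → ∀ᶠ N in atTop, (((B N : Set X) \ S).ncard : ℝ) ≤ ε * (B N).card := by
  have hcard : ∀ N, (0 : ℝ) < (B N).card := fun N => by exact_mod_cast (hB N).card_pos
  have hdist : ∀ N, dist (((S ∩ (B N : Set X)).ncard : ℝ) / ((B N).card : ℝ)) 1 =
      (((B N : Set X) \ S).ncard : ℝ) / (B N).card := by
    intro N
    have h1 := Set.ncard_inter_add_ncard_sdiff_eq_ncard (B N : Set X) S (B N).finite_toSet
    rw [Set.ncard_coe_finset, Set.inter_comm] at h1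
    have h2 : ((S ∩ (B N : Set X)).ncard : ℝ) + (((B N : Set X) \ S).ncard : ℝ) = (B N).card := by
      exact_mod_cast h1
    have h3 : ((S ∩ (B N : Set X)).ncard : ℝ) / ((B N).card : ℝ) - 1 =
        -((((B N : Set X) \ S).ncard : ℝ) / (B N).card) := by
      have := (hcard N).ne'
      field_simp
      linarith
    rw [Real.dist_eq, h3, abs_neg, abs_of_nonneg (by positivity)]
  rw [HasFullDensity, Metric.tendsto_nhds]
  simp only [hdist, div_lt_iff₀ (hcard _)]
  constructor
  · intro h ε hε
    exact (h ε hε).mono fun N hN => hN.le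
  · intro h ε hε
    refine (h (ε / 2) (by positivity)).mono fun N hN => hN.trans_lt ?_
    have := mul_pos hε (hcard N)
    linarith

lemma raySegment_nonempty (N : ℕ) : (raySegment N).Nonempty :=
  ⟨(0, 0), by simp [raySegment]⟩

lemma card_raySegment (N : ℕ) : (raySegment N).card = N + 1 := by
  simp [raySegment]

lemma squareBox_nonempty (N : ℕ) : (squareBox N).Nonempty :=
  ⟨(0, 0), by simp [squareBox]⟩

lemma card_squareBox (N : ℕ) : (squareBox N).card = (2 * N + 1) ^ 2 := by
  simp only [squareBox, Finset.card_product, Int.card_Icc]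
  rw [show ((N : ℤ) + 1 - -N).toNat = 2 * N + 1 by omega]
  ring

/-- A point of the ray which is not deep lies within a bounded distance of one of the finitely many
discontinuities at its level. -/
lemma exists_of_not_isDeep (hβ : β < α) {z : ℤ} (hz : 0 ≤ z)
    (h : ∀ ρ n e : ℤ, (z, 0) = site α β ρ n e → ¬ IsDeep α β ρ n e) :
    ∃ n r t : ℤ, 1 ≤ n ∧ (n ≤ 2 ∨ (n - 2) ^ 2 ≤ 2 * z) ∧ 0 ≤ r ∧ r ≤ alphaBar α β + 1 ∧
      |t| ≤ 20 * (α : ℤ) ^ 2 ∧ z = α * tri n - β * n - (r * gcdUnit α β * n + t) := by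
  obtain ⟨n, s, hn, hs, hsn, hp⟩ := exists_rayPt hβ hz
  have hU : (0 : ℤ) < gcdUnit α β := by exact_mod_cast gcdUnit_pos hβ
  have h2 : (gcdUnit α β : ℤ) * alphaBar α β = α := by exact_mod_cast gcdUnit_mul_alphaBar
  have hβ' : (β : ℤ) + 1 ≤ α := by exact_mod_cast hβ
  have hz' : z = α * tri n - β * n - s := (Prod.mk.inj hp).1
  have hUn : 0 < gcdUnit α β * n := by positivity
  have hn2 : n ≤ 2 ∨ (n - 2) ^ 2 ≤ 2 * z := by
    refine or_iff_not_imp_left.2 fun h3 => ?_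
    have ht := two_mul_tri n
    have e1 : 0 ≤ (n - 2) * (n - 1) * (α - 1 : ℤ) :=
      mul_nonneg (mul_nonneg (by omega) (by omega)) (by omega)
    have e2 : 0 ≤ (n - 1) * (α - 1 - β : ℤ) := mul_nonneg (by omega) (by omega)
    nlinarith
  have hmod := Int.emod_add_mul_ediv s (gcdUnit α β * n)
  have hm0 := Int.emod_nonneg s hUn.ne'
  have hm1 := Int.emod_lt_of_pos s hUn
  have hq0 : 0 ≤ s / (gcdUnit α β * n) := Int.ediv_nonneg hs.le hUn.le
  set q := s / (gcdUnit α β * n)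
  set e := s % (gcdUnit α β * n)
  have hqA : q ≤ alphaBar α β := by
    by_contra! hlt
    have : gcdUnit α β * n * (alphaBar α β + 1) ≤ gcdUnit α β * n * q :=
      mul_le_mul_of_nonneg_left (by omega) hUn.le
    nlinarith
  by_cases h1 : e ≤ 20 * (α : ℤ) ^ 2
  · exact ⟨n, q, e, hn, hn2, hq0, by omega, abs_le.2 ⟨by nlinarith, h1⟩, by rw [hz']; linarith⟩
  by_cases h3 : e + 20 * (α : ℤ) ^ 2 ≤ gcdUnit α β * n
  · refine (h q n e ?_ ⟨hq0, ?_, (not_le.1 h1).le, h3⟩).elim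
    swap
    · by_contra! hlt
      have : gcdUnit α β * n * alphaBar α β ≤ gcdUnit α β * n * q :=
        mul_le_mul_of_nonneg_left (by omega) hUn.le
      nlinarith
    · rw [hp, site]
      congr 1
      linarith
  -- The remainder is close to its upper end, so the nearest discontinuity is the next multiple.
  · exact ⟨n, q + 1, e - gcdUnit α β * n, hn, hn2, by omega, by omega,
      abs_le.2 ⟨by omega, by nlinarith⟩, by rw [hz']; linarith⟩

lemma ncard_raySegment_diff_le (hβ : β < α) {S : Set (ℤ × ℤ)}
    (hS : ∀ ρ n e : ℤ, IsDeep α β ρ n e → site α β ρ n e ∈ S) (N : ℕ) :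
    ((raySegment N : Set (ℤ × ℤ)) \ S).ncard ≤
      (Nat.sqrt (2 * N) + 2) * ((alphaBar α β + 2) * (40 * α ^ 2 + 1)) := by
  set T : Finset (ℤ × ℤ × ℤ) := Finset.Icc (1 : ℤ) (Nat.sqrt (2 * N) + 2 : ℕ) ×ˢ
    Finset.Icc (0 : ℤ) (alphaBar α β + 1 : ℕ) ×ˢ
    Finset.Icc (-(20 * α ^ 2 : ℕ) : ℤ) (20 * α ^ 2 : ℕ) with hT
  set f : ℤ × ℤ × ℤ → ℤ × ℤ := fun x =>
    (α * tri x.1 - β * x.1 - (x.2.1 * gcdUnit α β * x.1 + x.2.2), 0) with hf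
  have hsub : (raySegment N : Set (ℤ × ℤ)) \ S ⊆ (T.image f : Finset (ℤ × ℤ)) := by
    rintro ⟨z, y⟩ ⟨hp, hpS⟩
    simp only [raySegment, Finset.coe_product, Set.mem_prod, Finset.coe_Icc, Set.mem_Icc,
      Finset.coe_singleton, Set.mem_singleton_iff] at hp
    obtain ⟨⟨hz0, hzN⟩, rfl⟩ := hp
    obtain ⟨n, r, t, h1, h2, h3, h4, h5, h6⟩ := exists_of_not_isDeep hβ hz0
      fun ρ n e he hd => hpS (he ▸ hS ρ n e hd)
    rw [Finset.mem_coe, Finset.mem_image]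
    refine ⟨(n, r, t), ?_, by rw [hf, h6]⟩
    have h7 : n ≤ (Nat.sqrt (2 * N) + 2 : ℕ) := by
      have : (n - 2).toNat ≤ Nat.sqrt (2 * N) := by
        rw [Nat.le_sqrt]
        rcases h2 with hn | hn
        · simp [Int.toNat_eq_zero.2 (show n - 2 ≤ 0 by omega)]
        rcases le_or_gt n 2 with hn' | hn'
        · simp [Int.toNat_eq_zero.2 (show n - 2 ≤ 0 by omega)]
        · zify
          rw [Int.toNat_of_nonneg (by omega)]
          nlinarith
      omega
    have h8 := abs_le.1 h5
    simp only [hT, Finset.mem_product, Finset.mem_Icc]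
    push_cast at h7 ⊢
    exact ⟨⟨h1, h7⟩, ⟨h3, h4⟩, h8⟩
  calc ((raySegment N : Set (ℤ × ℤ)) \ S).ncard ≤ (T.image f : Set (ℤ × ℤ)).ncard :=
        Set.ncard_le_ncard hsub (Finset.finite_toSet _)
    _ ≤ T.card := by
        rw [Set.ncard_coe_finset]
        exact Finset.card_image_le
    _ = _ := by
        simp only [hT, Finset.card_product, Int.card_Icc]
        congr 2
        · omega
        · omega

lemma hasFullDensity_raySegment (hβ : β < α) {S : Set (ℤ × ℤ)}
    (hS : ∀ ρ n e : ℤ, IsDeep α β ρ n e → site α β ρ n e ∈ S) : HasFullDensity raySegment S := by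
  rw [hasFullDensity_iff raySegment_nonempty]
  intro ε hε
  set C : ℕ := (alphaBar α β + 2) * (40 * α ^ 2 + 1) with hC
  obtain ⟨k, hk⟩ := exists_nat_gt (4 * C / ε)
  rw [div_lt_iff₀ hε] at hk
  filter_upwards [eventually_ge_atTop ((k + 2) * (k + 2))] with N hN
  have h1 : ((((raySegment N : Set (ℤ × ℤ)) \ S).ncard : ℕ) : ℝ) ≤ (Nat.sqrt (2 * N) + 2) * C := by
    exact_mod_cast ncard_raySegment_diff_le hβ hS N
  refine h1.trans ?_
  rw [card_raySegment]
  have h2 : k + 2 ≤ Nat.sqrt (2 * N) := Nat.le_sqrt.2 (by omega)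
  have h3 : Nat.sqrt (2 * N) * Nat.sqrt (2 * N) ≤ 2 * N := Nat.sqrt_le _
  set r := Nat.sqrt (2 * N)
  have h2' : (k : ℝ) + 2 ≤ r := by exact_mod_cast h2
  have h3' : (r : ℝ) * r ≤ 2 * N := by exact_mod_cast h3
  have hk0 : (0 : ℝ) ≤ k := by positivity
  push_cast
  calc ((r : ℝ) + 2) * C ≤ (2 * r) * C := by gcongr; linarith
    _ = r * (4 * C) / 2 := by ring
    _ ≤ r * (r * ε) / 2 := by
        have : 4 * C ≤ r * ε := hk.le.trans (mul_le_mul_of_nonneg_right (by linarith) hε.le)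
        exact div_le_div_of_nonneg_right
          (mul_le_mul_of_nonneg_left this (by positivity)) zero_le_two
    _ = ε * (r * r / 2) := by ring
    _ ≤ ε * (N + 1) := by gcongr; linarith

lemma tri_nonneg (y : ℤ) : 0 ≤ tri y := by
  have h := two_mul_tri y
  rcases le_or_gt 0 y with hy | hy
  · nlinarith
  · nlinarith

lemma zpow_mem_iff {S : Set (ℤ × ℤ)} (hS : ∀ p, latticeMap α β p ∈ S ↔ p ∈ S) (k : ℤ)
    (p : ℤ × ℤ) : (latticeMap α β ^ k) p ∈ S ↔ p ∈ S := by
  induction k using Int.induction_on generalizing p with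
  | zero => simp
  | succ k ih => rw [zpow_add_one, Equiv.Perm.mul_apply, ih, hS]
  | pred k ih =>
    rw [zpow_sub_one, Equiv.Perm.mul_apply, ih, ← hS]
    exact iff_of_eq (congrArg (· ∈ S) ((latticeMap α β).apply_symm_apply p))

/-- The abscissa at which the right parabola through `p` meets the axis. -/
def axisHit (α β : ℕ) (p : ℤ × ℤ) : ℤ := p.1 + α * tri (p.2 - 1) + β * p.2

lemma rightPt_axisHit (p : ℤ × ℤ) : rightPt α β (axisHit α β p) p.2 = p := by
  ext
  · simp only [rightPt, axisHit]
    ring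
  · rfl

lemma axisHit_nonneg (hβ : β < α) {p : ℤ × ℤ} (hp : 0 ≤ p.1) : 0 ≤ axisHit α β p := by
  have hβ' : (β : ℤ) ≤ α := by exact_mod_cast hβ.le
  have h1 := tri_nonneg (p.2 - 1)
  have h2 := tri_nonneg p.2
  have h3 := two_mul_tri (p.2 - 1)
  have h4 := two_mul_tri p.2
  rw [axisHit]
  rcases le_or_gt 0 p.2 with hy | hy
  · positivity
  · have h5 := tri_nonneg (p.2 + 1)
    have h6 := two_mul_tri (p.2 + 1)
    have h7 : (0 : ℤ) ≤ α * (tri (p.2 - 1) + p.2) := mul_nonneg (by positivity) (by linarith)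
    have h8 : (0 : ℤ) ≤ (α - β) * (-p.2) := mul_nonneg (by omega) (by omega)
    nlinarith

lemma axisHit_mem_iff (hβ : β < α) {S : Set (ℤ × ℤ)} (hS : ∀ p, latticeMap α β p ∈ S ↔ p ∈ S)
    {p : ℤ × ℤ} (hp : 0 ≤ p.1) : (axisHit α β p, 0) ∈ S ↔ p ∈ S := by
  have hz := axisHit_nonneg hβ hp
  have hit : ∀ (k : ℕ) q, (latticeMap α β)^[k] q ∈ S ↔ q ∈ S := fun k q => by
    rw [Equiv.Perm.iterate_eq_pow, ← zpow_natCast, zpow_mem_iff hS]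
  have hp' : 0 ≤ (rightPt α β (axisHit α β p) p.2).1 := by rwa [rightPt_axisHit]
  have h0 : 0 ≤ (rightPt α β (axisHit α β p) 0).1 := by rwa [rightPt_zero]
  rcases le_or_gt 0 p.2 with hy | hy
  · have h := iterate_rightPt (α := α) (β := β) (z := axisHit α β p) (y := p.2) (k := p.2.toNat)
      fun t ht => rightPt_nonneg (a := 0) (b := p.2) (by omega) (by omega) h0 hp'
    rw [rightPt_axisHit, Int.toNat_of_nonneg hy, sub_self, rightPt_zero] at h
    rw [← h, hit]
  · have h := iterate_rightPt (α := α) (β := β) (z := axisHit α β p) (y := 0) (k := (-p.2).toNat)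
      fun t ht => rightPt_nonneg (a := p.2) (b := 0) (by omega) (by omega) hp' h0
    rw [Int.toNat_of_nonneg (by omega), zero_sub, neg_neg, rightPt_axisHit, rightPt_zero] at h
    conv_rhs => rw [← h, hit]

lemma exists_iterate_nonneg {h : ℤ} (hβ : β < α) (R : ℕ) {x y : ℤ} (hh : 0 < h) (hy : h ≤ y)
    (hx : x < 0) (hR : -x ≤ R * h) :
    ∃ k : ℕ, k ≤ R ∧ 0 ≤ ((latticeMap α β)^[k] (x, y)).1 ∧
      ((latticeMap α β)^[k] (x, y)).1 ≤ α * (((latticeMap α β)^[k] (x, y)).2 + 1) ∧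
      y ≤ ((latticeMap α β)^[k] (x, y)).2 ∧ ((latticeMap α β)^[k] (x, y)).2 ≤ y + R := by
  have hβ' : (β : ℤ) + 1 ≤ α := by exact_mod_cast hβ
  induction R generalizing x y with
  | zero => simp at hR; omega
  | succ R ih =>
    have hstep := latticeMap_of_neg (α := α) (β := β) (p := (x, y)) hx
    simp only at hstep
    rcases le_or_gt 0 (x + α * (y + 1) + β) with h1 | h1
    · refine ⟨1, by omega, ?_⟩
      rw [Function.iterate_one, hstep]
      push_cast
      refine ⟨h1, ?_, by omega, by omega⟩
      linarith
    · push_cast at hR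
      have : y + 1 ≤ α * (y + 1) := le_mul_of_one_le_left (by omega) (by omega)
      obtain ⟨k, hk, h2, h3, h4, h5⟩ := ih (x := x + α * (y + 1) + β) (y := y + 1)
        (by omega) h1 (by linarith)
      refine ⟨k + 1, by omega, ?_⟩
      rw [Function.iterate_succ_apply, hstep]
      push_cast
      exact ⟨h2, h3, by omega, by omega⟩

lemma exists_symm_iterate_nonneg {h : ℤ} (hβ : β < α) (R : ℕ) {x y : ℤ} (hh : 0 < h) (hy : y ≤ -h)
    (hx : x < 0) (hR : -x ≤ R * h) :
    ∃ k : ℕ, k ≤ R ∧ 0 ≤ ((latticeMap α β).symm^[k] (x, y)).1 ∧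
      ((latticeMap α β).symm^[k] (x, y)).1 ≤ α * (-((latticeMap α β).symm^[k] (x, y)).2 + 1) ∧
      ((latticeMap α β).symm^[k] (x, y)).2 ≤ y + 1 ∧
      y - R ≤ ((latticeMap α β).symm^[k] (x, y)).2 := by
  have hβ' : (β : ℤ) + 1 ≤ α := by exact_mod_cast hβ
  induction R generalizing x y with
  | zero => simp at hR; omega
  | succ R ih =>
    have hstep : (latticeMap α β).symm (x, y) =
      (x - α * y - β, y + latticeSign (x - α * y - β)) := rfl
    rcases le_or_gt 0 (x - α * y - β) with h1 | h1
    · refine ⟨1, by omega, ?_⟩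
      rw [Function.iterate_one, hstep, latticeSign, if_pos h1]
      push_cast
      refine ⟨h1, ?_, by omega, by omega⟩
      have : (0 : ℤ) ≤ β := by positivity
      nlinarith
    · rw [latticeSign, if_neg (by omega)] at hstep
      push_cast at hR
      have : h ≤ -α * y - β := by nlinarith
      obtain ⟨k, hk, h2, h3, h4, h5⟩ := ih (x := x - α * y - β) (y := y + -1)
        (by omega) h1 (by linarith)
      refine ⟨k + 1, by omega, ?_⟩
      rw [Function.iterate_succ_apply, hstep]
      push_cast
      exact ⟨h2, h3, by omega, by omega⟩

/-- A point of the box away from the axis `y = 0` reaches the half plane `0 ≤ x` in at most `K`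
steps, forwards or backwards. -/
lemma exists_zpow_nonneg (hβ : β < α) {N K h : ℕ} (hh : 0 < h) (hN : N ≤ K * (h + 1)) {p : ℤ × ℤ}
    (hx : |p.1| ≤ N) (hy : |p.2| ≤ N) (hy' : h + 1 ≤ |p.2|) :
    ∃ k : ℤ, |k| ≤ K ∧ 0 ≤ ((latticeMap α β ^ k) p).1 ∧
      ((latticeMap α β ^ k) p).1 ≤ α * (N + K + 2) ∧
      h ≤ |((latticeMap α β ^ k) p).2| ∧ |((latticeMap α β ^ k) p).2| ≤ N + K := by
  obtain ⟨x, y⟩ := p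
  simp only at hx hy hy'
  have hα : (1 : ℤ) ≤ α := by omega
  have hN' : (N : ℤ) ≤ K * (h + 1) := by exact_mod_cast hN
  rw [abs_le] at hx hy
  rcases le_or_gt 0 x with h0 | h0
  · refine ⟨0, by simp, h0, ?_, ?_, ?_⟩
    · simp only [zpow_zero, Equiv.Perm.one_apply]
      have : (N + K + 2 : ℤ) ≤ α * (N + K + 2) := le_mul_of_one_le_left (by positivity) hα
      linarith
    · simp only [zpow_zero, Equiv.Perm.one_apply]
      omega
    · simp only [zpow_zero, Equiv.Perm.one_apply, abs_le]
      omega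
  rcases le_or_gt 0 y with hy0 | hy0
  · rw [abs_of_nonneg hy0] at hy'
    obtain ⟨k, hk, h1, h2, h3, h4⟩ := exists_iterate_nonneg hβ K (h := h + 1) (by omega) hy' h0
      (by linarith)
    refine ⟨k, by simpa using hk, ?_⟩
    rw [zpow_natCast, ← Equiv.Perm.iterate_eq_pow]
    rw [abs_of_nonneg (by omega)]
    refine ⟨h1, h2.trans ?_, by omega, by omega⟩
    exact mul_le_mul_of_nonneg_left (by omega) (by omega)
  · rw [abs_of_neg hy0] at hy'
    obtain ⟨k, hk, h1, h2, h3, h4⟩ := exists_symm_iterate_nonneg hβ K (h := h + 1) (by omega)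
      (show y ≤ -(h + 1 : ℤ) by omega) h0 (by linarith)
    refine ⟨-k, by simpa using hk, ?_⟩
    rw [zpow_neg, zpow_natCast, ← inv_pow, ← Equiv.Perm.iterate_eq_pow]
    change 0 ≤ ((latticeMap α β).symm^[k] (x, y)).1 ∧ ((latticeMap α β).symm^[k] (x, y)).1 ≤ _ ∧
      _ ≤ |((latticeMap α β).symm^[k] (x, y)).2| ∧ |((latticeMap α β).symm^[k] (x, y)).2| ≤ _
    rw [abs_of_nonpos (by omega)]
    refine ⟨h1, h2.trans ?_, by omega, by omega⟩
    exact mul_le_mul_of_nonneg_left (by omega) (by omega)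

/-- Two points in a vertical strip of width `L`, on the same right parabola and on the same side
of the axis, are close to each other if both are far from the axis. -/
lemma axisHit_separation (hβ : β < α) {p q : ℤ × ℤ} {h L : ℤ} (hp : 0 ≤ p.1) (hpL : p.1 ≤ L)
    (hq : 0 ≤ q.1) (hqL : q.1 ≤ L) (hph : h ≤ |p.2|) (hqh : h ≤ |q.2|) (hs : 0 ≤ p.2 ↔ 0 ≤ q.2)
    (heq : axisHit α β p = axisHit α β q) (hlt : p.2 < q.2) : (q.2 - p.2) * (α * h) ≤ L := by
  have hβ' : (β : ℤ) ≤ α := by exact_mod_cast hβ.le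
  have hβ0 : (0 : ℤ) ≤ β := by positivity
  have h1 := two_mul_tri (p.2 - 1)
  have h2 := two_mul_tri (q.2 - 1)
  simp only [axisHit] at heq
  obtain ⟨d, hd⟩ : ∃ d, q.2 = p.2 + d := ⟨q.2 - p.2, by ring⟩
  have hd1 : 1 ≤ d := by omega
  rw [hd] at heq h2 ⊢
  rw [add_sub_cancel_left]
  rcases le_or_gt 0 p.2 with h0 | h0
  · rw [abs_of_nonneg h0] at hph
    have e1 : d * h ≤ tri (p.2 + d - 1) - tri (p.2 - 1) := by nlinarith
    have e2 : (α : ℤ) * (d * h) ≤ α * (tri (p.2 + d - 1) - tri (p.2 - 1)) :=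
      mul_le_mul_of_nonneg_left e1 (by omega)
    have e3 : 0 ≤ β * d := by positivity
    nlinarith
  · have hq0 : q.2 < 0 := by omega
    rw [abs_of_neg hq0, hd] at hqh
    have e1 : d * h + d ≤ tri (p.2 - 1) - tri (p.2 + d - 1) := by nlinarith
    have e2 : (α : ℤ) * (d * h + d) ≤ α * (tri (p.2 - 1) - tri (p.2 + d - 1)) :=
      mul_le_mul_of_nonneg_left e1 (by omega)
    have e3 : β * d ≤ α * d := mul_le_mul_of_nonneg_right hβ' (by omega)
    nlinarith

lemma axisHit_le (hβ : β < α) {N K : ℕ} (hN : 0 < N) (hK : K ≤ N) {p : ℤ × ℤ}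
    (hp : p.1 ≤ α * (N + K + 2)) (hy : |p.2| ≤ N + K) : axisHit α β p ≤ (9 * α * N ^ 2 : ℕ) := by
  have hβ' : (β : ℤ) ≤ α := by exact_mod_cast hβ.le
  have hK' : (K : ℤ) ≤ N := by exact_mod_cast hK
  have hN' : (1 : ℤ) ≤ N := by exact_mod_cast hN
  have h1 := two_mul_tri (p.2 - 1)
  obtain ⟨h2, h3⟩ := abs_le.1 hy
  have e1 : tri (p.2 - 1) ≤ 2 * N ^ 2 + N := by nlinarith
  have e2 : (α : ℤ) * tri (p.2 - 1) ≤ α * (2 * N ^ 2 + N) :=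
    mul_le_mul_of_nonneg_left e1 (by omega)
  have e3 : (β : ℤ) * p.2 ≤ α * (2 * N) := by nlinarith
  have e4 : (α : ℤ) * (N + K + 2) ≤ α * (4 * N) := mul_le_mul_of_nonneg_left (by linarith) (by omega)
  have e5 : (α : ℤ) * (7 * N) ≤ α * (7 * N ^ 2) := mul_le_mul_of_nonneg_left (by nlinarith) (by omega)
  rw [axisHit]
  push_cast
  linarith

/-- Outside a strip around the axis, the points of the box that miss the invariant set `S` are
counted by the points of the ray that miss `S`, with a multiplicity that does not depend on the size
of the box. -/
lemma ncard_squareBox_diff_le (hβ : β < α) {S : Set (ℤ × ℤ)}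
    (hS : ∀ p, latticeMap α β p ∈ S ↔ p ∈ S) {N K : ℕ} (hK : 0 < K) (hN : K ≤ N) :
    ((squareBox N : Set (ℤ × ℤ)) \ S).ncard ≤ (2 * N + 1) * (2 * (N / K) + 1) +
      (2 * K + 1) * (2 * (8 * K)) * ((raySegment (9 * α * N ^ 2) : Set (ℤ × ℤ)) \ S).ncard := by
  classical
  set h := N / K with hh
  have hh0 : 0 < h := Nat.div_pos hN hK
  have hNh : N < K * (h + 1) := by
    have := Nat.lt_div_mul_add hK (a := N)
    rw [mul_comm, ← hh] at this
    linarith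
  set strip : Finset (ℤ × ℤ) := Finset.Icc (-(N : ℤ)) N ×ˢ Finset.Icc (-(h : ℤ)) h with hstrip
  set far : Finset (ℤ × ℤ) := (squareBox N).filter fun p => p ∉ S ∧ (h : ℤ) + 1 ≤ |p.2| with hfar
  set ray : Finset (ℤ × ℤ) := (raySegment (9 * α * N ^ 2)).filter fun p => p ∉ S with hray
  have hcover : (squareBox N : Set (ℤ × ℤ)) \ S ⊆ (strip ∪ far : Finset (ℤ × ℤ)) := by
    rintro p ⟨hp, hpS⟩
    rw [Finset.mem_coe] at hp
    rw [Finset.mem_coe, Finset.mem_union]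
    rcases le_or_gt ((h : ℤ) + 1) |p.2| with h1 | h1
    · exact Or.inr (Finset.mem_filter.2 ⟨hp, hpS, h1⟩)
    · left
      simp only [squareBox, hstrip, Finset.mem_product, Finset.mem_Icc] at hp ⊢
      exact ⟨hp.1, by rw [← abs_le]; omega⟩
  have hmove : ∀ p ∈ far, ∃ k : ℤ, |k| ≤ K ∧ 0 ≤ ((latticeMap α β ^ k) p).1 ∧
      ((latticeMap α β ^ k) p).1 ≤ α * (N + K + 2) ∧
      h ≤ |((latticeMap α β ^ k) p).2| ∧ |((latticeMap α β ^ k) p).2| ≤ N + K := by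
    intro p hp
    obtain ⟨hp1, -, hp2⟩ := Finset.mem_filter.1 hp
    simp only [squareBox, Finset.mem_product, Finset.mem_Icc] at hp1
    exact exists_zpow_nonneg hβ hh0 hNh.le (abs_le.2 hp1.1) (abs_le.2 hp1.2) hp2
  choose! k hk using hmove
  set code : ℤ × ℤ → ℤ × (Bool × ℤ) × (ℤ × ℤ) := fun p =>
    (k p, (decide (0 ≤ ((latticeMap α β ^ k p) p).2), ((latticeMap α β ^ k p) p).2 % (8 * K)),
      (axisHit α β ((latticeMap α β ^ k p) p), 0)) with hcode
  set target : Finset (ℤ × (Bool × ℤ) × (ℤ × ℤ)) := Finset.Icc (-(K : ℤ)) K ×ˢ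
    ((Finset.univ : Finset Bool) ×ˢ Finset.Ico (0 : ℤ) (8 * K : ℕ)) ×ˢ ray with htarget
  have hmaps : ∀ p ∈ far, code p ∈ target := by
    intro p hp
    obtain ⟨h1, h2, h3, h4, h5⟩ := hk p hp
    have h6 := axisHit_nonneg hβ h2
    have h7 := axisHit_le hβ (by omega) hN h3 h5
    have h8 : (axisHit α β ((latticeMap α β ^ k p) p), (0 : ℤ)) ∉ S := by
      rw [axisHit_mem_iff hβ hS h2, zpow_mem_iff hS]
      exact (Finset.mem_filter.1 hp).2.1
    simp only [hcode, htarget, hray, raySegment, Finset.mem_product, Finset.mem_Icc,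
      Finset.mem_univ, Finset.mem_Ico, Finset.mem_filter, Finset.mem_singleton, true_and]
    refine ⟨abs_le.1 h1, ⟨Int.emod_nonneg _ (by omega), ?_⟩, ⟨⟨h6, h7⟩, trivial⟩, h8⟩
    push_cast
    exact Int.emod_lt_of_pos _ (by omega)
  have hinj : Set.InjOn code (far : Set (ℤ × ℤ)) := by
    intro p hp q hq hpq
    obtain ⟨-, h2, h3, h4, h5⟩ := hk p hp
    obtain ⟨-, g2, g3, g4, g5⟩ := hk q hq
    simp only [hcode, Prod.mk.injEq, decide_eq_decide, and_true] at hpq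
    obtain ⟨e1, ⟨e2, e3⟩, e4⟩ := hpq
    have hclose : ∀ d : ℤ, d * (α * h) ≤ α * (N + K + 2) → d < 8 * K := by
      intro d hd
      by_contra! hge
      have hα : (0 : ℤ) < α := by omega
      have i1 : (8 * K : ℤ) * h ≤ d * h := mul_le_mul_of_nonneg_right hge (by positivity)
      have i2 : d * h ≤ N + K + 2 := by
        refine le_of_mul_le_mul_left ?_ hα
        linarith
      have i3 : (N : ℤ) < K * (h + 1) := by exact_mod_cast hNh
      have i4 : (K : ℤ) ≤ K * h := le_mul_of_one_le_right (by positivity) (by exact_mod_cast hh0)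
      have i5 : (1 : ℤ) ≤ K := by exact_mod_cast hK
      linarith
    have hy : ((latticeMap α β ^ k p) p).2 = ((latticeMap α β ^ k q) q).2 := by
      have hdvd := Int.ModEq.dvd e3
      rcases lt_trichotomy ((latticeMap α β ^ k p) p).2 ((latticeMap α β ^ k q) q).2 with hl | he | hl
      · have := hclose _ (axisHit_separation hβ h2 h3 g2 g3 h4 g4 e2 e4 hl)
        exact absurd (Int.le_of_dvd (by omega) hdvd) (by omega)
      · exact he
      · have := hclose _ (axisHit_separation hβ g2 g3 h2 h3 g4 h4 e2.symm e4.symm hl)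
        exact absurd (Int.le_of_dvd (by omega) ((dvd_sub_comm).1 hdvd)) (by omega)
    have hpt : (latticeMap α β ^ k p) p = (latticeMap α β ^ k q) q := by
      rw [← rightPt_axisHit (α := α) (β := β) ((latticeMap α β ^ k p) p), e4, hy, rightPt_axisHit]
    rw [e1] at hpt
    exact (latticeMap α β ^ k q).injective hpt
  have hray_card : ray.card = ((raySegment (9 * α * N ^ 2) : Set (ℤ × ℤ)) \ S).ncard := by
    rw [← Set.ncard_coe_finset, hray, Finset.coe_filter]
    rfl
  calc ((squareBox N : Set (ℤ × ℤ)) \ S).ncard ≤ (strip ∪ far).card := by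
        rw [← Set.ncard_coe_finset]
        exact Set.ncard_le_ncard hcover (Finset.finite_toSet _)
    _ ≤ strip.card + far.card := Finset.card_union_le _ _
    _ ≤ strip.card + target.card :=
        Nat.add_le_add_left (Finset.card_le_card_of_injOn code hmaps hinj) _
    _ = _ := by
        simp only [hstrip, htarget, Finset.card_product, Int.card_Icc, Int.card_Ico, hray_card,
          Finset.card_univ, Fintype.card_bool]
        rw [show ((N : ℤ) + 1 - -N).toNat = 2 * N + 1 by omega,
          show ((h : ℤ) + 1 - -h).toNat = 2 * h + 1 by omega,
          show ((K : ℤ) + 1 - -K).toNat = 2 * K + 1 by omega,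
          show (((8 * K : ℕ) : ℤ) - 0).toNat = 8 * K by omega]
        ring

lemma hasFullDensity_squareBox (hβ : β < α) {S : Set (ℤ × ℤ)}
    (hS : ∀ p, latticeMap α β p ∈ S ↔ p ∈ S) (hray : HasFullDensity raySegment S) :
    HasFullDensity squareBox S := by
  rw [hasFullDensity_iff squareBox_nonempty]
  rw [hasFullDensity_iff raySegment_nonempty] at hray
  intro ε hε
  obtain ⟨K, hK⟩ := exists_nat_gt (6 / ε)
  have hK0 : (0 : ℝ) < K := lt_trans (by positivity) hK
  have hK0' : 0 < K := by exact_mod_cast hK0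
  have hα : (1 : ℝ) ≤ α := by exact_mod_cast (show 1 ≤ α by omega)
  set C : ℕ := (2 * K + 1) * (2 * (8 * K)) with hC
  have hC0 : (0 : ℝ) < C := by
    rw [hC]
    push_cast
    positivity
  have hlim : Tendsto (fun N : ℕ => 9 * α * N ^ 2) atTop atTop := by
    refine tendsto_atTop_mono (fun N => ?_) tendsto_id
    have : 1 ≤ 9 * α := by omega
    calc N ≤ 1 * N ^ 2 := by rw [one_mul]; exact Nat.le_self_pow two_ne_zero N
      _ ≤ 9 * α * N ^ 2 := Nat.mul_le_mul_right _ this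
  filter_upwards [hlim.eventually (hray (ε / (18 * α * C)) (by positivity)), eventually_ge_atTop K]
    with N h1 hN
  have h2 : (((squareBox N : Set (ℤ × ℤ)) \ S).ncard : ℝ) ≤
      ((2 * N + 1) * (2 * (N / K : ℕ) + 1) +
      C * ((raySegment (9 * α * N ^ 2) : Set (ℤ × ℤ)) \ S).ncard : ℝ) := by
    exact_mod_cast ncard_squareBox_diff_le hβ hS hK0' hN
  rw [card_raySegment] at h1
  rw [card_squareBox]
  push_cast at h1 ⊢
  have hNr : (K : ℝ) ≤ N := by exact_mod_cast hN
  have h3 : (2 * (N / K : ℕ) + 1 : ℝ) ≤ ε / 2 * (2 * N + 1) := by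
    have a1 : ((N / K : ℕ) : ℝ) ≤ N / K := Nat.cast_div_le
    have a2 : (1 : ℝ) ≤ N / K := by rwa [one_le_div hK0]
    have a3 : (N : ℝ) / K ≤ ε / 6 * N := by
      rw [div_le_iff₀ hK0]
      have : 6 < K * ε := by rwa [div_lt_iff₀ hε] at hK
      nlinarith
    nlinarith
  have h4 : (C * ((raySegment (9 * α * N ^ 2) : Set (ℤ × ℤ)) \ S).ncard : ℝ) ≤
      ε / 2 * (2 * N + 1) ^ 2 := by
    calc (C * ((raySegment (9 * α * N ^ 2) : Set (ℤ × ℤ)) \ S).ncard : ℝ)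
        ≤ C * (ε / (18 * α * C) * (9 * α * N ^ 2 + 1)) := by gcongr
      _ ≤ C * (ε / (18 * α * C) * (9 * α * (2 * N + 1) ^ 2)) := by
          gcongr
          have : (0 : ℝ) ≤ N := by positivity
          nlinarith [mul_nonneg (mul_nonneg (zero_le_one.trans hα) this) this]
      _ = ε / 2 * (2 * N + 1) ^ 2 := by
          field_simp
          ring
  calc _ ≤ _ := h2
    _ ≤ (2 * N + 1) * (ε / 2 * (2 * N + 1)) + ε / 2 * (2 * N + 1) ^ 2 := by gcongr
    _ = _ := by ring

lemma isPeriodicPoint_map_iff {p : ℤ × ℤ} :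
    IsPeriodicPoint α β (latticeMap α β p) ↔ IsPeriodicPoint α β p := by
  constructor
  · rintro ⟨P, hP, h⟩
    refine ⟨P, hP, (latticeMap α β).injective ?_⟩
    rw [← Function.iterate_succ_apply' (latticeMap α β), Function.iterate_succ_apply]
    exact h
  · rintro ⟨P, hP, h⟩
    exact ⟨P, hP, h.map (Function.Commute.refl _)⟩

end

theorem theorem1 (α β : ℕ) (hβ : β < α) :
    (Odd (alphaBar α β) →
      HasFullDensity raySegment
        {p | IsPeriodicPoint α β p ∧
          Function.minimalPeriod (firstReturn α β) p = alphaBar α β} ∧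
      HasFullDensity squareBox
        {p | IsPeriodicPoint α β p ∧
          ∃ t : ℕ, (latticeMap α β)^[t] p ∈ positiveRay ∧
            Function.minimalPeriod (firstReturn α β) ((latticeMap α β)^[t] p) =
              alphaBar α β}) ∧
    (Even (alphaBar α β) →
      HasFullDensity raySegment {p | IsEscapePoint α β p} ∧
      HasFullDensity squareBox {p | IsEscapePoint α β p}) := by
  constructor
  · intro hodd
    refine ⟨hasFullDensity_raySegment hβ fun ρ n e h => (h.isPeriodic_of_odd hβ hodd).symm,
      hasFullDensity_squareBox hβ ?_ (hasFullDensity_raySegment hβ fun ρ n e h => ?_)⟩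
    · intro p
      simp only [Set.mem_ofPred_eq, isPeriodicPoint_map_iff]
      refine and_congr_right fun hp => ?_
      constructor
      · rintro ⟨t, ht⟩
        exact ⟨t + 1, ht⟩
      · rintro ⟨t, ht⟩
        obtain ⟨P, hP, hper⟩ := hp
        -- The time `t` is shifted by one period, so that one step can be split off.
        have : (latticeMap α β)^[t + (P - 1)] (latticeMap α β p) = (latticeMap α β)^[t] p := by
          rw [← Function.iterate_succ_apply, show (t + (P - 1)).succ = t + P by omega,
            Function.iterate_add_apply, hper.eq]
        exact ⟨t + (P - 1), by rwa [this]⟩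
    · obtain ⟨h1, h2⟩ := h.isPeriodic_of_odd hβ hodd
      obtain ⟨a1, a2, a3, -⟩ := h.bounds hβ (k := 0) (by omega)
      refine ⟨h2, 0, ?_, h1⟩
      rw [Function.iterate_zero, id, ← h.rayPt_zero]
      exact ⟨rayPt_mem hβ a1 a3, rfl⟩
  · intro heven
    have hray : HasFullDensity raySegment {p | IsEscapePoint α β p} :=
      hasFullDensity_raySegment hβ fun ρ n e h =>
        isEscapePoint_iff.2 (h.not_isPeriodicPoint hβ heven)
    refine ⟨hray, hasFullDensity_squareBox hβ (fun p => ?_) hray⟩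
    simp only [Set.mem_ofPred_eq, isEscapePoint_iff, isPeriodicPoint_map_iff]
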